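/- Let $n,d\ge 1$ and let $n$ point masses $m_1,\dots,m_n>0$ in $\mathbb R^d$ be given. Let $M=\mathrm{diag}(m_1\mathrm{Id}_d,\dots,m_n\mathrm{Id}_d)$, $U(q)=\sum_{i<j}\frac{m_im_j}{|q_i-q_j|}$, $X=\{q\in(\mathbb R^d)^n:\sum_i m_iq_i=0\}$, and let $\hat X$ be the set of $q\in X$ with $q_i\ne q_j$ for all $i\neq j$. Let $\mathcal E=\{q\in X:\langle Mq,q\rangle=1\}$, and let $s_0\in\mathcal E\cap\hat X$ be a central configuration, i.e. a critical point of $U|_{\mathcal E}$. Let $\lambda_1(s_0)$ be the smallest eigenvalue of the Hessian of $U|_{\mathcal E}$ at $s_0$ with respect to the mass inner product, i.e. of the bilinear form $D^2U(s_0)[v,w]+U(s_0)\langle Mv,w\rangle$ on $T_{s_0}\mathcal E=\{v\in X:\langle Ms_0,v\rangle=0\}$ relative to $\langle Mv,w\rangle$ (with $\lambda_1(s_0)=+\infty$ if $T_{s_0}\mathcal E=0$). Let $0<T^+<\infty$ and let $q\in C^2([0,T^+),\hat X)$ be a solution of Newton's equations $M\ddot q=\nabla U(q)$ of the form $q(t)=r(t)s_0$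 with $r>0$, such that $q(t)\to 0$ as $t\to T^+$. For $0<t<T^+$ let $m^-(q;0,t)$ be the Morse index of $q|_{[0,t]}$, that is, the supremum of the dimensions of the linear subspaces of $W_0^{1,2}([0,t],X)$ on which the second variation at $q$ of the action $\mathcal A(q)=\int_0^t\big(\tfrac12\langle M\dot q,\dot q\rangle+U(q)\big)\,d\tau$ is negative definite. Let $m^-(q;0,T^+)=\lim_{k\to\infty}m^-(q;0,t_k)$ for any sequence $t_k\in(0,T^+)$ with $t_k\to T^+$. Then this limit exists in $\{0,1,2,\dots\}\cup\{+\infty\}$ and does not depend on the sequence in each of the following two cases, where it has the stated value: (a) if $s_0$ satisfies the spiral condition $\lambda_1(s_0)<-U(s_0)/8$, then $m^-(q;0,T^+)=+\infty$; (b) if $s_0$ satisfies the non-spiral condition $\lambda_1(s_0)\ge -U(s_0)/8$ and $\dot r(0)\le 0$ (the motion is not expanding at the initial time), then $m^-(q;0,T^+)=0$, whatever the energy of $q$ and whatever the Morse index of $s_0$. -/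

import Mathlib

open Set Filter Topology MeasureTheory

noncomputable section

namespace NBody

/-- Configurations of `n` points of `ℝ^d`, with the Euclidean structure of `ℝ^{dn}`. -/
abbrev Config (n d : ℕ) : Type :=
  PiLp 2 (fun _ : Fin n => EuclideanSpace ℝ (Fin d))

variable {n d : ℕ}

/-- The mass matrix `M`: the `i`-th body is multiplied by `m i`. -/
def massMap (m : Fin n → ℝ) : Config n d →ₗ[ℝ] Config n d where
  toFun q := WithLp.toLp 2 (fun i => m i • q i)
  map_add' x y := by ext i k; simp
  map_smul' c x := by ext i k; simp [mul_left_comm]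

/-- The Newtonian potential `U(q) = ∑_{i<j} m_i m_j / |q_i - q_j|`.
It is only ever used at, or near, collision-free configurations. -/
def potential (m : Fin n → ℝ) (q : Config n d) : ℝ :=
  ∑ i : Fin n, ∑ j ∈ Finset.Ioi i, m i * m j / ‖q i - q j‖

/-- The configuration space `X`: center of mass at the origin. -/
def configSpace (m : Fin n → ℝ) : Submodule ℝ (Config n d) where
  carrier := {q | ∑ i, m i • q i = 0}
  zero_mem' := by simp
  add_mem' {x y} hx hy := by
    simp only [Set.mem_ofPred_eq] at hx hy ⊢
    simp [smul_add, Finset.sum_add_distrib, hx, hy]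
  smul_mem' c x hx := by
    simp only [Set.mem_ofPred_eq] at hx ⊢
    simp only [PiLp.smul_apply, smul_comm _ c, ← Finset.smul_sum, hx, smul_zero]

/-- The collision set `Δ`. -/
def collisionSet : Set (Config n d) :=
  {q | ∃ i j, i ≠ j ∧ q i = q j}

/-- The collision-free configurations `X \ Δ`. -/
def collisionFree (m : Fin n → ℝ) : Set (Config n d) :=
  {q | q ∈ configSpace m ∧ q ∉ collisionSet}

/-- The moment of inertia `I(q) = ⟨M q, q⟩`. -/
def inertia (m : Fin n → ℝ) (q : Config n d) : ℝ := inner ℝ (massMap m q) q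

/-- The normalized configurations (inertia ellipsoid) `E = {q ∈ X | I(q) = 1}`. -/
def ellipsoid (m : Fin n → ℝ) : Set (Config n d) :=
  {q | q ∈ configSpace m ∧ inertia m q = 1}

/-- The tangent space `T_s E = {v ∈ X | ⟨M s, v⟩ = 0}` of the inertia ellipsoid at `s`. -/
def ellipsoidTangent (m : Fin n → ℝ) (s : Config n d) : Submodule ℝ (Config n d) :=
  configSpace m ⊓ (Submodule.span ℝ {massMap m s})ᗮ

/-- A (normalized) central configuration: a collision-free critical point of the restriction
of `U` to `E`, i.e. the differential of `U` vanishes on the tangent space. -/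
def IsCentralConfig (m : Fin n → ℝ) (s : Config n d) : Prop :=
  s ∈ ellipsoid m ∧ s ∈ collisionFree m ∧
    ∀ v ∈ ellipsoidTangent m s, fderiv ℝ (potential m) s v = 0

/-- The Hessian at a central configuration `s` of the restriction of `U` to `E`, as a bilinear
form (to be used on `T_s E`): `D²U(s)[v, w] + U(s) ⟨M v, w⟩`. -/
def restrictedHessian (m : Fin n → ℝ) (s v w : Config n d) : ℝ :=
  fderiv ℝ (fderiv ℝ (potential m)) s v w + potential m s * inner ℝ (massMap m v) w

/-- The eigenvalues of `M⁻¹ D²U|_E(s)`, the endomorphism of `T_s E` which represents the Hessian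
of `U|_E` with respect to the mass inner product `⟨M v, w⟩`. -/
def hessianSpectrum (m : Fin n → ℝ) (s : Config n d) : Set ℝ :=
  {l | ∃ v ∈ ellipsoidTangent m s, v ≠ 0 ∧
    ∀ w ∈ ellipsoidTangent m s, restrictedHessian m s v w = l * inner ℝ (massMap m v) w}

/-- The smallest eigenvalue `λ₁(s)` (equal to `+∞` when `T_s E` is the zero space, so that there
are no eigenvalues). -/
def lambdaOne (m : Fin n → ℝ) (s : Config n d) : EReal :=
  sInf (Real.toEReal '' hessianSpectrum m s)

/-- The spiral condition `λ₁(s) < -U(s)/8`. -/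
def IsSpiral (m : Fin n → ℝ) (s : Config n d) : Prop :=
  lambdaOne m s < ((-(potential m s / 8) : ℝ) : EReal)

/-- The non-spiral condition `λ₁(s) ≥ -U(s)/8`. -/
def IsNonSpiral (m : Fin n → ℝ) (s : Config n d) : Prop :=
  ((-(potential m s / 8) : ℝ) : EReal) ≤ lambdaOne m s

/-- The Lagrangian `L(x, v) = ½ ⟨M v, v⟩ + U(x)`. -/
def lagrangian (m : Fin n → ℝ) (x v : Config n d) : ℝ :=
  (1 / 2) * inner ℝ (massMap m v) v + potential m x

/-- The Lagrangian action on `[a, b]`. -/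
def action (m : Fin n → ℝ) (a b : ℝ) (q : ℝ → Config n d) : ℝ :=
  ∫ t in a..b, lagrangian m (q t) (deriv q t)

/-- The Sobolev space `W₀^{1,2}([a, b], X)`: the absolutely continuous `X`-valued functions on
`[a, b]` which have a square integrable derivative `v` and vanish at `a` and at `b`; each one is
represented by its extension by zero to the real line. -/
def sobolevZero (m : Fin n → ℝ) (a b : ℝ) : Submodule ℝ (ℝ → Config n d) where
  carrier := {ξ | (∀ t, ξ t ∈ configSpace m) ∧ (∀ t, t ∉ Ioo a b → ξ t = 0) ∧
    ∃ v : ℝ → Config n d, MemLp v 2 (volume.restrict (Icc a b)) ∧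
      ∀ t ∈ Icc a b, ξ t = ∫ s in a..t, v s}
  zero_mem' := ⟨fun _ => Submodule.zero_mem _, fun _ _ => rfl, 0, MemLp.zero, by simp⟩
  add_mem' := by
    rintro x y ⟨hx1, hx2, v, hv, hxv⟩ ⟨hy1, hy2, w, hw, hyw⟩
    refine ⟨fun t => Submodule.add_mem _ (hx1 t) (hy1 t), fun t ht => ?_, v + w, hv.add hw, ?_⟩
    · simp [hx2 t ht, hy2 t ht]
    · intro t ht
      have key : ∀ u : ℝ → Config n d, MemLp u 2 (volume.restrict (Icc a b)) →
          IntervalIntegrable u volume a t := by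
        intro u hu
        rw [intervalIntegrable_iff_integrableOn_Ioc_of_le ht.1]
        exact IntegrableOn.mono_set (hu.integrable (by norm_num))
          (fun z hz => ⟨hz.1.le, hz.2.trans ht.2⟩)
      simp only [Pi.add_apply]
      rw [intervalIntegral.integral_add (key v hv) (key w hw), hxv t ht, hyw t ht]
  smul_mem' := by
    rintro c x ⟨hx1, hx2, v, hv, hxv⟩
    refine ⟨fun t => Submodule.smul_mem _ c (hx1 t), fun t ht => ?_, c • v, hv.const_smul c, ?_⟩
    · simp [hx2 t ht]
    · intro t ht
      simp only [Pi.smul_apply]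
      rw [intervalIntegral.integral_smul, hxv t ht]

/-- The second variation at `q` of the action on `[a, b]`, in the direction `ξ`. -/
def secondVariation (m : Fin n → ℝ) (a b : ℝ) (q ξ : ℝ → Config n d) : ℝ :=
  iteratedDeriv 2 (fun ε : ℝ => action m a b (q + ε • ξ)) 0

/-- The Morse index of `q` on `[a, b]`: the supremum of the dimensions of the subspaces of
`W₀^{1,2}([a, b], X)` on which the second variation of the action is negative definite. -/
def morseIndex (m : Fin n → ℝ) (a b : ℝ) (q : ℝ → Config n d) : ℕ∞ :=
  ⨆ V ∈ {V : Submodule ℝ (ℝ → Config n d) | V ≤ sobolevZero m a b ∧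
    ∀ ξ ∈ V, ξ ≠ 0 → secondVariation m a b q ξ < 0}, Cardinal.toENat (Module.rank ℝ V)

/-- The Morse index of `q` on the half-open interval `[0, T)` exists and is equal to `k`: the
Morse indices on `[0, t_j]` converge to `k` for every sequence `t_j` in `(0, T)` tending to `T`. -/
def HasMorseIndex (m : Fin n → ℝ) (T : ℝ) (q : ℝ → Config n d) (k : ℕ∞) : Prop :=
  ∀ t : ℕ → ℝ, (∀ j, t j ∈ Ioo 0 T) → Tendsto t atTop (𝓝 T) →
    Tendsto (fun j => morseIndex m 0 (t j) q) atTop (𝓝 k)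

/-- `q(t) = r(t) s` is a `C²` homothetic solution on `[0, T)` of Newton's equations
`M q'' = ∇U(q)`, without collisions before `T` and with total collapse at the time `T`. Values of
`q` and `r` outside `[0, T)` are irrelevant; derivatives at `0` are one-sided. -/
structure IsCollidingHomothetic (m : Fin n → ℝ) (s : Config n d) (T : ℝ)
    (r : ℝ → ℝ) (q : ℝ → Config n d) : Prop where
  time_pos : 0 < T
  r_pos : ∀ t ∈ Ico 0 T, 0 < r t
  eq_smul : ∀ t ∈ Ico 0 T, q t = r t • s
  contDiffOn : ContDiffOn ℝ 2 q (Ico 0 T)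
  mem_collisionFree : ∀ t ∈ Ico 0 T, q t ∈ collisionFree m
  newton : ∀ t ∈ Ico 0 T,
    massMap m (iteratedDerivWithin 2 q (Ico 0 T) t) = gradient (potential m) (q t)
  collapse : Tendsto q (𝓝[<] T) (𝓝 0)

end NBody

end

namespace NBody

variable {n d : ℕ}

/-! Along `q = r s₀` the Hessian of `U` scales like r⁻³, so the second variation in a direction ξ
with derivative v is ∫ ⟨Mv, v⟩ + r⁻³ D²U(s₀)[ξ, ξ]. Comparing D²U(s₀) with −κM reduces the question
to the sign of the scalar forms ∫ g'² − κ r⁻³ g². The restricted Hessian exceeds D²U by U·M, so the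
threshold λ₁ = −U/8 corresponds to κ = 9U/8. Energy conservation makes r³ asymptotic to (9U/2)(T−t)²
at the collapse, hence κ r⁻³ is asymptotic to (2κ/9U)(T−t)⁻², and κ = 9U/8 yields exactly the
critical Hardy constant 1/4.

Non-spiral case: D²U(s₀) ≥ −(9U/8)M on all of X (`IsNonSpiral.hessian_ge`), since the radial
direction contributes a positive term. The scalar form with κ = 9U/8 is nonnegative as soon as φ' +
φ² ≤ −κ r⁻³ has a solution (`hardy_of_riccati`). The logarithmic derivative of r^(3/4) is one when
the energy is nonnegative, that of r^(5/4)|r'| when it is nonpositive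
(`IsKeplerCollapse.exists_riccati`). At zero energy both functions are multiples of √(T−t), the
critical solution of the limiting Euler equation.

Spiral case: some direction has κ > 9U/8, so near T the coefficient κ r⁻³ exceeds (1/4+β²)(T−t)⁻²
for some β > 0 (`IsKeplerCollapse.cube_le`). The Euler equation with that coefficient has a solution
with infinitely many zeros accumulating at T. Each arc between consecutive zeros is a negative
direction, and disjoint arcs are independent (`IsCollidingHomothetic.le_morseIndex`), so the index
grows without bound. -/

/-! ### The mass inner product and the homogeneity of the potential. -/

theorem inner_massMap (m : Fin n → ℝ) (x y : Config n d) :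
    inner ℝ (massMap m x) y = ∑ i, m i * inner ℝ (x i) (y i) := by
  rw [PiLp.inner_apply]
  exact Finset.sum_congr rfl fun i _ => real_inner_smul_left _ _ _

theorem inner_massMap_eq_sum_coord (m : Fin n → ℝ) (x y : Config n d) :
    inner ℝ (massMap m x) y = ∑ i, ∑ k, m i * (x i k * y i k) := by
  rw [inner_massMap]
  refine Finset.sum_congr rfl fun i _ => ?_
  rw [PiLp.inner_apply, Finset.mul_sum]
  exact Finset.sum_congr rfl fun k _ => by simp [mul_comm]

theorem inner_massMap_comm (m : Fin n → ℝ) (x y : Config n d) :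
    inner ℝ (massMap m x) y = inner ℝ (massMap m y) x := by
  simp only [inner_massMap_eq_sum_coord, mul_comm]

theorem inner_massMap_self_nonneg {m : Fin n → ℝ} (hm : ∀ i, 0 < m i) (x : Config n d) :
    0 ≤ inner ℝ (massMap m x) x := by
  rw [inner_massMap]
  exact Finset.sum_nonneg fun i _ => mul_nonneg (hm i).le real_inner_self_nonneg

theorem inner_massMap_self_pos {m : Fin n → ℝ} (hm : ∀ i, 0 < m i) {x : Config n d} (hx : x ≠ 0) :
    0 < inner ℝ (massMap m x) x := by
  rw [inner_massMap]
  obtain ⟨i, hi⟩ : ∃ i, x i ≠ 0 := by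
    by_contra! h
    exact hx (by ext1 i; simpa using h i)
  refine Finset.sum_pos' (fun i _ => mul_nonneg (hm i).le real_inner_self_nonneg)
    ⟨i, Finset.mem_univ _, mul_pos (hm i) (real_inner_self_pos.2 hi)⟩

/-- The continuous bilinear form `⟨L x, y⟩`. -/
noncomputable def innerForm {E : Type*} [NormedAddCommGroup E] [InnerProductSpace ℝ E]
    [FiniteDimensional ℝ E] (L : E →ₗ[ℝ] E) : E →L[ℝ] E →L[ℝ] ℝ :=
  (innerSL ℝ).comp L.toContinuousLinearMap

/-- The mass inner product as a continuous bilinear form. -/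
noncomputable def massForm (m : Fin n → ℝ) : Config n d →L[ℝ] Config n d →L[ℝ] ℝ :=
  innerForm (massMap m)

theorem massForm_apply (m : Fin n → ℝ) (x y : Config n d) :
    massForm m x y = inner ℝ (massMap m x) y := rfl

theorem massForm_comm (m : Fin n → ℝ) (x y : Config n d) : massForm m x y = massForm m y x :=
  inner_massMap_comm m x y

theorem isOpen_compl_collisionSet : IsOpen (collisionSet : Set (Config n d))ᶜ := by
  have : (collisionSet : Set (Config n d)) = ⋃ i, ⋃ j, ⋃ _ : i ≠ j, {q | q i = q j} := by
    ext q; simp [collisionSet]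
  rw [this, isOpen_compl_iff]
  refine isClosed_iUnion_of_finite fun i => isClosed_iUnion_of_finite fun j =>
    isClosed_iUnion_of_finite fun _ => isClosed_eq ?_ ?_ <;> fun_prop

theorem contDiffAt_potential (m : Fin n → ℝ) {q : Config n d} (hq : q ∉ collisionSet) :
    ContDiffAt ℝ ⊤ (potential m) q := by
  unfold potential
  refine ContDiffAt.sum fun i _ => ContDiffAt.sum fun j hj => ?_
  have hij : q i - q j ≠ 0 := fun h =>
    hq ⟨i, j, (Finset.mem_Ioi.1 hj).ne, sub_eq_zero.1 h⟩
  refine ContDiffAt.div contDiffAt_const (ContDiffAt.norm ℝ ?_ hij) (norm_ne_zero_iff.2 hij)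
  fun_prop

theorem potential_smul (m : Fin n → ℝ) {ρ : ℝ} (hρ : 0 < ρ) (x : Config n d) :
    potential m (ρ • x) = ρ⁻¹ * potential m x := by
  simp only [potential, Finset.mul_sum]
  refine Finset.sum_congr rfl fun i _ => Finset.sum_congr rfl fun j _ => ?_
  rw [PiLp.smul_apply, PiLp.smul_apply, ← smul_sub, norm_smul, Real.norm_of_nonneg hρ.le]
  rw [div_eq_mul_inv, mul_inv, div_eq_mul_inv]; ring

/-- The derivative of a positively homogeneous function is positively homogeneous. -/
theorem fderiv_smul_of_homogeneous {E F : Type*} [NormedAddCommGroup E] [NormedSpace ℝ E]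
    [NormedAddCommGroup F] [NormedSpace ℝ F] {f : E → F} {ρ c : ℝ} (hρ : ρ ≠ 0)
    (hf : ∀ x, f (ρ • x) = c • f x) (x : E) :
    fderiv ℝ f (ρ • x) = (ρ⁻¹ * c) • fderiv ℝ f x := by
  have h := fderiv_comp_smul (𝕜 := ℝ) (f := f) (x := x) ρ
  have h2 : (fun y => f (ρ • y)) = c • f := by ext y; simp [hf]
  rw [h2, fderiv_const_smul_field, Pi.smul_apply] at h
  rw [mul_smul, h, smul_smul, inv_mul_cancel₀ hρ, one_smul]

/-- Euler's identity for positively homogeneous functions. -/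
theorem fderiv_self_of_homogeneous {E F : Type*} [NormedAddCommGroup E] [NormedSpace ℝ E]
    [NormedAddCommGroup F] [NormedSpace ℝ F] {f : E → F} {g : ℝ → ℝ} {g' : ℝ} {s : E}
    (hf : ∀ ρ : ℝ, 0 < ρ → f (ρ • s) = g ρ • f s) (hg : HasDerivAt g g' 1)
    (hs : DifferentiableAt ℝ f s) : fderiv ℝ f s s = g' • f s := by
  have h1 : HasDerivAt (fun ρ : ℝ => f (ρ • s)) (fderiv ℝ f s s) 1 := by
    have h' : HasDerivAt (fun ρ : ℝ => ρ • s) s 1 := by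
      simpa using (hasDerivAt_id (1 : ℝ)).smul_const s
    refine HasFDerivAt.comp_hasDerivAt (f := fun ρ : ℝ => ρ • s) (1 : ℝ) ?_ h'
    simpa using hs.hasFDerivAt
  refine h1.unique ((hg.smul_const (f s)).congr_of_eventuallyEq ?_)
  filter_upwards [lt_mem_nhds (zero_lt_one' ℝ)] with ρ hρ using hf ρ hρ

theorem fderiv_potential_smul (m : Fin n → ℝ) {ρ : ℝ} (hρ : 0 < ρ) (x : Config n d) :
    fderiv ℝ (potential m) (ρ • x) = (ρ⁻¹ * ρ⁻¹) • fderiv ℝ (potential m) x :=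
  fderiv_smul_of_homogeneous hρ.ne' (potential_smul m hρ) x

theorem fderiv_fderiv_potential_smul (m : Fin n → ℝ) {ρ : ℝ} (hρ : 0 < ρ) (x : Config n d) :
    fderiv ℝ (fderiv ℝ (potential m)) (ρ • x) =
      (ρ ^ 3)⁻¹ • fderiv ℝ (fderiv ℝ (potential m)) x := by
  rw [fderiv_smul_of_homogeneous hρ.ne' (fderiv_potential_smul m hρ) x]
  congr 1; field_simp

theorem differentiableAt_fderiv_potential (m : Fin n → ℝ) {s : Config n d}
    (hs : s ∉ collisionSet) : DifferentiableAt ℝ (fderiv ℝ (potential m)) s :=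
  ((contDiffAt_potential m hs).fderiv_right (m := 1) (by simp)).differentiableAt (by simp)

theorem fderiv_potential_self (m : Fin n → ℝ) {s : Config n d} (hs : s ∉ collisionSet) :
    fderiv ℝ (potential m) s s = -potential m s := by
  have h := fderiv_self_of_homogeneous (fun ρ hρ => potential_smul m hρ s)
    (hasDerivAt_inv (one_ne_zero' ℝ)) ((contDiffAt_potential m hs).differentiableAt (by simp))
  simpa using h

/-- Euler's identity for the degree −2 map dU. At a central configuration it decouples the radial
direction: the mixed terms with tangent vectors vanish and D²U(s)[s, s] = 2U(s). -/
theorem fderiv_fderiv_potential_self (m : Fin n → ℝ) {s : Config n d} (hs : s ∉ collisionSet) :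
    fderiv ℝ (fderiv ℝ (potential m)) s s = (-2 : ℝ) • fderiv ℝ (potential m) s := by
  have h0 := hasDerivAt_inv (one_ne_zero' ℝ)
  have h := fderiv_self_of_homogeneous (fun ρ hρ => fderiv_potential_smul m hρ s)
    (h0.mul h0) (differentiableAt_fderiv_potential m hs)
  rw [h]
  norm_num

theorem fderiv_fderiv_potential_comm (m : Fin n → ℝ) {s : Config n d} (hs : s ∉ collisionSet)
    (v w : Config n d) : fderiv ℝ (fderiv ℝ (potential m)) s v w =
      fderiv ℝ (fderiv ℝ (potential m)) s w v :=
  ((contDiffAt_potential m hs).isSymmSndFDerivAt (by simp)).eq v w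

/-- The sum is empty for at most one body, but then centering forces s = 0, against the
normalization of the inertia. -/
theorem IsCentralConfig.potential_pos {m : Fin n → ℝ} (hm : ∀ i, 0 < m i) {s : Config n d}
    (hs : IsCentralConfig m s) : 0 < potential m s := by
  obtain ⟨⟨hX, hI⟩, ⟨-, hc⟩, -⟩ := hs
  obtain ⟨i, j, hij⟩ : ∃ i j : Fin n, i < j := by
    by_contra! h
    have hsub : Subsingleton (Fin n) := ⟨fun i j => le_antisymm (h j i) (h i j)⟩
    have hs0 : s = 0 := by
      ext1 i
      have h1 : ∑ j, m j • s j = 0 := hX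
      rw [Fintype.sum_subsingleton _ i] at h1
      simpa [(hm i).ne'] using h1
    simp [inertia, hs0] at hI
  have hp : ∀ i j : Fin n, i ≠ j → 0 < m i * m j / ‖s i - s j‖ := fun i j h =>
    div_pos (mul_pos (hm i) (hm j)) (norm_pos_iff.2 (sub_ne_zero.2 fun h' => hc ⟨i, j, h, h'⟩))
  unfold potential
  have hn : ∀ i : Fin n, ∀ j ∈ Finset.Ioi i, 0 ≤ m i * m j / ‖s i - s j‖ := fun i j hj =>
    (hp i j (Finset.mem_Ioi.1 hj).ne).le
  exact Finset.sum_pos' (fun i _ => Finset.sum_nonneg (hn i)) ⟨i, Finset.mem_univ _,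
    Finset.sum_pos' (hn i) ⟨j, Finset.mem_Ioi.2 hij, hp i j hij.ne⟩⟩

/-! ### The spectral condition as a bound on the Hessian of the potential. -/

theorem mem_ellipsoidTangent_iff {m : Fin n → ℝ} {s v : Config n d} :
    v ∈ ellipsoidTangent m s ↔ v ∈ configSpace m ∧ inner ℝ (massMap m s) v = 0 := by
  simp [ellipsoidTangent, Submodule.mem_orthogonal_singleton_iff_inner_right]

/-- The infimum of the Rayleigh quotient of a symmetric form on a nonzero subspace is an
eigenvalue. -/
theorem exists_minimal_eigenvalue {E : Type*} [NormedAddCommGroup E] [NormedSpace ℝ E]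
    [FiniteDimensional ℝ E] (A B : E →L[ℝ] E →L[ℝ] ℝ) (hA : ∀ v w, A v w = A w v)
    (hpos : ∀ v, v ≠ 0 → 0 < A v v) (hB : ∀ v w, B v w = B w v)
    (W : Submodule ℝ E) (hW : W ≠ ⊥) :
    ∃ μ : ℝ, (∃ v ∈ W, v ≠ 0 ∧ ∀ w ∈ W, B v w = μ * A v w) ∧
      ∀ w ∈ W, μ * A w w ≤ B w w := by
  obtain ⟨w₀, hw₀, hw₀0⟩ := W.ne_bot_iff.1 hW
  have := FiniteDimensional.proper_real E
  set S : Set E := (W : Set E) ∩ Metric.sphere 0 1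
  have hS : IsCompact S := (isCompact_sphere 0 1).inter_left W.closed_of_finiteDimensional
  have hSne : S.Nonempty := ⟨‖w₀‖⁻¹ • w₀, W.smul_mem _ hw₀, by
    simp [norm_smul, inv_mul_cancel₀ (norm_ne_zero_iff.2 hw₀0)]⟩
  have hS0 : ∀ v ∈ S, v ≠ 0 := by
    rintro v ⟨-, hv⟩ rfl; simp at hv
  have hcont : ContinuousOn (fun v => B v v / A v v) S :=
    ContinuousOn.div (by fun_prop) (by fun_prop) fun v hv => (hpos v (hS0 v hv)).ne'
  obtain ⟨v, hvS, hmin⟩ := hS.exists_isMinOn hSne hcont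
  set μ := B v v / A v v with hμ
  have hvpos := hpos v (hS0 v hvS)
  have hmin' : ∀ w ∈ W, μ * A w w ≤ B w w := by
    intro w hw
    by_cases h0 : w = 0
    · simp [h0]
    have hn := norm_ne_zero_iff.2 h0
    have h1 : μ ≤ B (‖w‖⁻¹ • w) (‖w‖⁻¹ • w) / A (‖w‖⁻¹ • w) (‖w‖⁻¹ • w) :=
      hmin (show ‖w‖⁻¹ • w ∈ S from ⟨W.smul_mem _ hw, by
      simp [norm_smul, inv_mul_cancel₀ hn]⟩)
    have hw0 := hpos w h0
    rw [← le_div_iff₀ hw0]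
    refine h1.trans_eq ?_
    simp only [map_smul, smul_eq_mul, smul_apply]
    field_simp
  refine ⟨μ, ⟨v, hvS.1, hS0 v hvS, fun w hw => ?_⟩, hmin'⟩
  have hv0 : B v v = μ * A v v := by rw [hμ]; field_simp
  -- B − μA is nonnegative on W and vanishes at v. Along v + xw it is a quadratic without constant
  -- term, so the sign of its discriminant kills the linear coefficient.
  have key : ∀ x : ℝ, 0 ≤ (B w w - μ * A w w) * (x * x) + 2 * (B v w - μ * A v w) * x + 0 := by
    intro x
    have h := hmin' (v + x • w) (W.add_mem hvS.1 (W.smul_mem _ hw))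
    simp only [map_add, map_smul, smul_eq_mul, smul_apply, add_apply, hB w v, hA w v] at h
    linarith
  have := discrim_le_zero key
  simp only [discrim, mul_zero, sub_zero] at this
  have h0 : B v w - μ * A v w = 0 := by
    nlinarith [sq_nonneg (B v w - μ * A v w)]
  linarith

/-- On the tangent space, 9/8 = 1/8 + 1, the 1 undoing the shift by U in `restrictedHessian`.
Writing x = a s + y with y tangent, the radial part adds 2U a² ≥ 0 and there are no cross terms. -/
theorem IsNonSpiral.hessian_ge {m : Fin n → ℝ} (hm : ∀ i, 0 < m i) {s : Config n d}
    (hs : IsCentralConfig m s) (h : IsNonSpiral m s) {x : Config n d} (hx : x ∈ configSpace m) :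
    -(9 / 8 * potential m s) * inner ℝ (massMap m x) x ≤
      fderiv ℝ (fderiv ℝ (potential m)) s x x := by
  have hu := hs.potential_pos hm
  obtain ⟨⟨hX, hI⟩, ⟨-, hc⟩, hcrit⟩ := hs
  have hT : ∀ y ∈ ellipsoidTangent m s, -(9 / 8 * potential m s) * inner ℝ (massMap m y) y ≤
      fderiv ℝ (fderiv ℝ (potential m)) s y y := by
    intro y hy
    by_cases hW : ellipsoidTangent m s = ⊥
    · rw [hW, Submodule.mem_bot] at hy
      simp [hy]
    obtain ⟨μ, ⟨v, hv, hv0, hvw⟩, hmin⟩ := exists_minimal_eigenvalue (massForm m) _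
      (massForm_comm m) (fun v hv => inner_massMap_self_pos hm hv)
      (fderiv_fderiv_potential_comm m hc) (ellipsoidTangent m s) hW
    have hmem : μ + potential m s ∈ hessianSpectrum m s :=
      ⟨v, hv, hv0, fun w hw => by
          rw [restrictedHessian, hvw w hw, massForm_apply]; ring⟩
    have hle : ((-(potential m s / 8) : ℝ) : EReal) ≤ ((μ + potential m s : ℝ) : EReal) :=
      h.trans (sInf_le ⟨_, hmem, rfl⟩)
    rw [EReal.coe_le_coe_iff] at hle
    refine le_trans ?_ (hmin y hy)
    exact mul_le_mul_of_nonneg_right (by linarith) (inner_massMap_self_nonneg hm y)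
  have hI' : inner ℝ (massMap m s) s = (1 : ℝ) := hI
  set a := inner ℝ (massMap m s) x with ha
  set y := x - a • s with hy
  have hyT : y ∈ ellipsoidTangent m s := mem_ellipsoidTangent_iff.2
    ⟨Submodule.sub_mem _ hx (Submodule.smul_mem _ _ hX), by
      simp [hy, inner_sub_right, real_inner_smul_right, hI', ha]⟩
  have hxy : x = a • s + y := by simp [hy]
  have h1 := hT y hyT
  have h2 := (mem_ellipsoidTangent_iff.1 hyT).2
  have h3 := hcrit y hyT
  rw [hxy]
  simp only [map_add, map_smul, inner_add_left, inner_add_right, real_inner_smul_left,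
      real_inner_smul_right, smul_eq_mul, smul_apply,
      add_apply, fderiv_fderiv_potential_comm m hc y s,
      inner_massMap_comm m y s, fderiv_fderiv_potential_self m hc, h2, h3, hI',
      fderiv_potential_self m hc]
  nlinarith [sq_nonneg a, mul_nonneg hu.le (sq_nonneg a)]

theorem IsSpiral.exists_direction {m : Fin n → ℝ} {s : Config n d} (h : IsSpiral m s) :
    ∃ κ, 9 / 8 * potential m s < κ ∧ ∃ v ∈ configSpace m, v ≠ 0 ∧
      fderiv ℝ (fderiv ℝ (potential m)) s v v = -κ * inner ℝ (massMap m v) v := by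
  obtain ⟨_, ⟨l, ⟨v, hv, hv0, hvw⟩, rfl⟩, hl⟩ := sInf_lt_iff.1 h
  rw [EReal.coe_lt_coe_iff] at hl
  refine ⟨potential m s - l, by linarith, v, hv.1, hv0, ?_⟩
  have := hvw v hv
  rw [restrictedHessian] at this
  linarith

/-! ### The second variation of the action. -/

/-- Differentiation under the integral sign for continuous integrands. -/
theorem hasDerivAt_integral_of_continuousOn {a b δ : ℝ} (hab : a ≤ b) {G G' : ℝ → ℝ → ℝ}
    (hG : ContinuousOn (Function.uncurry G) (Icc (-δ) δ ×ˢ Icc a b))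
    (hG' : ContinuousOn (Function.uncurry G') (Icc (-δ) δ ×ˢ Icc a b))
    (hd : ∀ ε ∈ Icc (-δ) δ, ∀ t ∈ Icc a b, HasDerivAt (fun ε => G ε t) (G' ε t) ε)
    {ε : ℝ} (hε : ε ∈ Ioo (-δ) δ) :
    HasDerivAt (fun ε => ∫ t in a..b, G ε t) (∫ t in a..b, G' ε t) ε := by
  obtain ⟨C, hC⟩ := (isCompact_Icc.prod isCompact_Icc).exists_bound_of_continuousOn hG'
  have hsec : ∀ {H : ℝ → ℝ → ℝ}, ContinuousOn (Function.uncurry H) (Icc (-δ) δ ×ˢ Icc a b) →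
      ∀ x ∈ Icc (-δ) δ, ContinuousOn (H x) (Icc a b) := fun hH x hx =>
    hH.comp (f := fun t => (x, t)) (by fun_prop) fun t ht => ⟨hx, ht⟩
  have hmeas : ∀ {H : ℝ → ℝ → ℝ}, ContinuousOn (Function.uncurry H) (Icc (-δ) δ ×ˢ Icc a b) →
      ∀ x ∈ Icc (-δ) δ, IntervalIntegrable (H x) volume a b := fun hH x hx =>
    (hsec hH x hx).intervalIntegrable_of_Icc hab
  have hnhds := Ioo_mem_nhds hε.1 hε.2
  refine (intervalIntegral.hasDerivAt_integral_of_dominated_loc_of_deriv_le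
    (F' := G') (bound := fun _ => C) hnhds ?_ (hmeas hG ε (Ioo_subset_Icc_self hε))
    (hmeas hG' ε (Ioo_subset_Icc_self hε)).def'.aestronglyMeasurable ?_ (by simp) ?_).2
  · filter_upwards [hnhds] with x hx using
      (hmeas hG x (Ioo_subset_Icc_self hx)).def'.aestronglyMeasurable
  · refine Eventually.of_forall fun t ht x hx => hC (x, t) ⟨Ioo_subset_Icc_self hx, ?_⟩
    rw [uIoc_of_le hab] at ht
    exact Ioc_subset_Icc_self ht
  · refine Eventually.of_forall fun t ht x hx => hd x (Ioo_subset_Icc_self hx) t ?_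
    rw [uIoc_of_le hab] at ht
    exact Ioc_subset_Icc_self ht

section Action

variable {E : Type*} [NormedAddCommGroup E] [NormedSpace ℝ E]

/-- Compactness of [a, b] gives one δ for all times; it keeps the varied paths away from collisions,
where U is smooth. -/
theorem exists_tube {Ω : Set E} (hΩ : IsOpen Ω) {a b : ℝ} {γ η : ℝ → E}
    (hγ : Continuous γ) (hη : Continuous η) (hmem : ∀ t ∈ Icc a b, γ t ∈ Ω) :
    ∃ δ : ℝ, 0 < δ ∧ ∀ ε ∈ Icc (-δ) δ, ∀ t ∈ Icc a b, γ t + ε • η t ∈ Ω := by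
  have hc : Continuous (fun p : ℝ × ℝ => γ p.2 + p.1 • η p.2) := by fun_prop
  obtain ⟨u, w, hu, -, h0u, hw, huw⟩ := generalized_tube_lemma (isCompact_singleton (x := (0 : ℝ)))
    (isCompact_Icc (a := a) (b := b)) (hΩ.preimage hc) (by
      rintro ⟨e, t⟩ ⟨he, ht⟩
      simp only [mem_singleton_iff] at he
      simpa [he] using hmem t ht)
  obtain ⟨δ, hδ, hδu⟩ := Metric.nhds_basis_closedBall.mem_iff.1 (hu.mem_nhds (h0u rfl))
  rw [Real.closedBall_eq_Icc, zero_sub, zero_add] at hδu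
  exact ⟨δ, hδ, fun ε hε t ht => huw (mk_mem_prod (hδu hε) (hw ht))⟩

theorem hasDerivAt_twice_integral_comp {U : E → ℝ} {Ω : Set E} (hΩ : IsOpen Ω)
    (hU : ContDiffOn ℝ 2 U Ω) {a b : ℝ} (hab : a ≤ b) {γ η : ℝ → E}
    (hγ : Continuous γ) (hη : Continuous η) (hmem : ∀ t ∈ Icc a b, γ t ∈ Ω) :
    ∃ F' : ℝ → ℝ,
      (∀ᶠ ε : ℝ in 𝓝 0, HasDerivAt (fun ε : ℝ => ∫ t in a..b, U (γ t + ε • η t)) (F' ε) ε) ∧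
      HasDerivAt F' (∫ t in a..b, fderiv ℝ (fderiv ℝ U) (γ t) (η t) (η t)) 0 := by
  have hc : Continuous (fun p : ℝ × ℝ => γ p.2 + p.1 • η p.2) := by fun_prop
  obtain ⟨δ, hδ, hδm⟩ := exists_tube hΩ hγ hη hmem
  have hmaps : ∀ p ∈ Icc (-δ) δ ×ˢ Icc a b, γ p.2 + p.1 • η p.2 ∈ Ω := fun p hp =>
    hδm p.1 hp.1 p.2 hp.2
  have hU1 : ContDiffOn ℝ 1 (fderiv ℝ U) Ω := hU.fderiv_of_isOpen hΩ (by norm_num)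
  have hU2 : ContinuousOn (fderiv ℝ (fderiv ℝ U)) Ω :=
    hU1.continuousOn_fderiv_of_isOpen hΩ le_rfl
  have hcurve : ∀ t ε : ℝ, HasDerivAt (fun ε : ℝ => γ t + ε • η t) (η t) ε := fun t ε => by
    simpa using ((hasDerivAt_id ε).smul_const (η t)).const_add (γ t)
  have hηc : ContinuousOn (fun p : ℝ × ℝ => η p.2) (Icc (-δ) δ ×ˢ Icc a b) := by fun_prop
  have hG : ContinuousOn (Function.uncurry fun ε t : ℝ => U (γ t + ε • η t))
      (Icc (-δ) δ ×ˢ Icc a b) := hU.continuousOn.comp hc.continuousOn hmaps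
  have hG1 : ContinuousOn (Function.uncurry fun ε t : ℝ => fderiv ℝ U (γ t + ε • η t) (η t))
      (Icc (-δ) δ ×ˢ Icc a b) := (hU1.continuousOn.comp hc.continuousOn hmaps).clm_apply hηc
  have hG2 : ContinuousOn (Function.uncurry fun ε t : ℝ =>
      fderiv ℝ (fderiv ℝ U) (γ t + ε • η t) (η t) (η t)) (Icc (-δ) δ ×ˢ Icc a b) :=
    ((hU2.comp hc.continuousOn hmaps).clm_apply hηc).clm_apply hηc
  refine ⟨fun ε => ∫ t in a..b, fderiv ℝ U (γ t + ε • η t) (η t), ?_, ?_⟩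
  · filter_upwards [Ioo_mem_nhds (neg_lt_zero.2 hδ) hδ] with ε hε
    refine hasDerivAt_integral_of_continuousOn hab hG hG1 (fun ε hε t ht => ?_) hε
    have hx := hΩ.mem_nhds (hmaps (ε, t) ⟨hε, ht⟩)
    exact ((hU.contDiffAt hx).differentiableAt (by norm_num)).hasFDerivAt.comp_hasDerivAt ε
      (hcurve t ε)
  · have h := hasDerivAt_integral_of_continuousOn hab hG1 hG2 (fun ε hε t ht => ?_)
      (show (0 : ℝ) ∈ Ioo (-δ) δ from ⟨neg_lt_zero.2 hδ, hδ⟩)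
    · simpa using h
    · have hx := hΩ.mem_nhds (hmaps (ε, t) ⟨hε, ht⟩)
      have h1 := ((hU1.contDiffAt hx).differentiableAt (by norm_num)).hasFDerivAt.comp_hasDerivAt ε
        (hcurve t ε)
      simpa using h1.clm_apply (hasDerivAt_const ε (η t))

theorem integrable_bilin {α : Type*} [MeasurableSpace α] {μ : Measure α}
    (B : E →L[ℝ] E →L[ℝ] ℝ) {x y : α → E} (hx : MemLp x 2 μ) (hy : MemLp y 2 μ) :
    Integrable (fun t => B (x t) (y t)) μ :=
  memLp_one_iff_integrable.1 (B.memLp_of_bilin 1 hx hy)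

theorem _root_.ContinuousOn.memLp_restrict_Icc {F : Type*} [NormedAddCommGroup F] {f : ℝ → F}
    {a b : ℝ} (hf : ContinuousOn f (Icc a b)) : MemLp f 2 (volume.restrict (Icc a b)) := by
  obtain ⟨C, hC⟩ := isCompact_Icc.exists_bound_of_continuousOn hf
  exact MemLp.of_bound (hf.aestronglyMeasurable_of_isCompact isCompact_Icc measurableSet_Icc) C
    ((ae_restrict_iff' measurableSet_Icc).2 (Eventually.of_forall hC))

theorem intervalIntegrable_of_memLp {F : Type*} [NormedAddCommGroup F] {v : ℝ → F} {a b : ℝ}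
    (hab : a ≤ b)
    (hv : MemLp v 2 (volume.restrict (Icc a b))) : IntervalIntegrable v volume a b :=
  (intervalIntegrable_iff_integrableOn_Icc_of_le hab).2 (hv.integrable (by norm_num))

theorem ae_hasDerivAt_of_eq_integral [CompleteSpace E] {ξ v : ℝ → E} {a b : ℝ} (hab : a ≤ b)
    (hv : IntervalIntegrable v volume a b) (hξ : ∀ t ∈ Icc a b, ξ t = ∫ s in a..t, v s) :
    ∀ᵐ t, t ∈ Ioo a b → HasDerivAt ξ (v t) t := by
  filter_upwards [hv.ae_hasDerivAt_integral] with t ht htI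
  rw [uIcc_of_le hab] at ht
  refine (ht (Ioo_subset_Icc_self htI) a (left_mem_Icc.2 hab)).congr_of_eventuallyEq ?_
  filter_upwards [Icc_mem_nhds htI.1 htI.2] with s hs using hξ s hs

theorem continuousOn_of_eq_integral [CompleteSpace E] {ξ v : ℝ → E} {a b : ℝ} (hab : a ≤ b)
    (hv : IntervalIntegrable v volume a b) (hξ : ∀ t ∈ Icc a b, ξ t = ∫ s in a..t, v s) :
    ContinuousOn ξ (Icc a b) := by
  have h := intervalIntegral.continuousOn_primitive_interval'
    hv (left_mem_uIcc)
  rw [uIcc_of_le hab] at h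
  exact h.congr hξ

theorem intervalIntegral_congr_Ioo_ae {f g : ℝ → ℝ} {a b : ℝ} (hab : a ≤ b)
    (h : ∀ᵐ t, t ∈ Ioo a b → f t = g t) : ∫ t in a..b, f t = ∫ t in a..b, g t := by
  refine intervalIntegral.integral_congr_ae ?_
  filter_upwards [h, Measure.ae_ne volume b] with t ht htb htI
  rw [uIoc_of_le hab] at htI
  exact ht ⟨htI.1, lt_of_le_of_ne htI.2 htb⟩

/-- The second variation of an action with Lagrangian `½ B(v, v) + U(x)`. -/
theorem iteratedDeriv_two_action [CompleteSpace E] (B : E →L[ℝ] E →L[ℝ] ℝ)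
    (hB : ∀ x y, B x y = B y x) {U : E → ℝ} {Ω : Set E} (hΩ : IsOpen Ω)
    (hU : ContDiffOn ℝ 2 U Ω) {a b : ℝ} (hab : a ≤ b) {q dq ξ v : ℝ → E}
    (hq : ContinuousOn q (Icc a b)) (hdq : ContinuousOn dq (Icc a b))
    (hqd : ∀ t ∈ Ioo a b, HasDerivAt q (dq t) t) (hmem : ∀ t ∈ Icc a b, q t ∈ Ω)
    (hv : MemLp v 2 (volume.restrict (Icc a b)))
    (hξ : ∀ t ∈ Icc a b, ξ t = ∫ s in a..t, v s) :
    iteratedDeriv 2 (fun ε : ℝ => ∫ t in a..b, ((1 / 2) *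
      B (deriv (q + ε • ξ) t) (deriv (q + ε • ξ) t) + U ((q + ε • ξ) t))) 0 =
    (∫ t in a..b, B (v t) (v t)) + ∫ t in a..b, fderiv ℝ (fderiv ℝ U) (q t) (ξ t) (ξ t) := by
  have hvi := intervalIntegrable_of_memLp hab hv
  have hξc := continuousOn_of_eq_integral hab hvi hξ
  have hdq2 := hdq.memLp_restrict_Icc
  have hint : ∀ {x y : ℝ → E}, MemLp x 2 (volume.restrict (Icc a b)) →
      MemLp y 2 (volume.restrict (Icc a b)) →
      IntervalIntegrable (fun t => B (x t) (y t)) volume a b := fun hx hy =>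
    (intervalIntegrable_iff_integrableOn_Icc_of_le hab).2 (integrable_bilin B hx hy)
  -- The paths are continuous only on [a, b]; extending them by their endpoint values gives globally
  -- continuous ones with the same integrals.
  set γ := IccExtend hab ((Icc a b).domRestrict q) with hγ
  set η := IccExtend hab ((Icc a b).domRestrict ξ) with hη
  have hγq : ∀ t ∈ Icc a b, γ t = q t := fun t ht => by
    simp [hγ, IccExtend_of_mem hab _ ht, domRestrict_apply]
  have hηξ : ∀ t ∈ Icc a b, η t = ξ t := fun t ht => by
    simp [hη, IccExtend_of_mem hab _ ht, domRestrict_apply]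
  have hγc : Continuous γ := (continuousOn_iff_continuous_domRestrict.1 hq).Icc_extend'
  have hηc : Continuous η := (continuousOn_iff_continuous_domRestrict.1 hξc).Icc_extend'
  obtain ⟨F', hF', hF''⟩ := hasDerivAt_twice_integral_comp hΩ hU hab hγc hηc
    (fun t ht => (hγq t ht).symm ▸ hmem t ht)
  set A₀ := ∫ t in a..b, (1 / 2) * B (dq t) (dq t)
  set A₁ := ∫ t in a..b, B (dq t) (v t)
  set A₂ := ∫ t in a..b, (1 / 2) * B (v t) (v t) with hA₂
  have hlast : ∫ t in a..b, fderiv ℝ (fderiv ℝ U) (γ t) (η t) (η t) =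
      ∫ t in a..b, fderiv ℝ (fderiv ℝ U) (q t) (ξ t) (ξ t) :=
    intervalIntegral_congr_Ioo_ae hab (Eventually.of_forall fun t ht => by
      rw [hγq t (Ioo_subset_Icc_self ht), hηξ t (Ioo_subset_Icc_self ht)])
  rw [hlast] at hF''
  -- As v is merely square integrable, the kinetic term is expanded as an exact quadratic polynomial
  -- in ε; only the potential term is differentiated under the integral.
  have hev : (fun ε : ℝ => ∫ t in a..b, ((1 / 2) *
      B (deriv (q + ε • ξ) t) (deriv (q + ε • ξ) t) + U ((q + ε • ξ) t))) =ᶠ[𝓝 0]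
      fun ε : ℝ => (A₀ + ε * A₁ + ε ^ 2 * A₂) + ∫ t in a..b, U (γ t + ε • η t) := by
    obtain ⟨δ, hδ, hδm⟩ := exists_tube hΩ hγc hηc (fun t ht => (hγq t ht).symm ▸ hmem t ht)
    filter_upwards [Ioo_mem_nhds (neg_lt_zero.2 hδ) hδ] with ε hε
    have hUi : IntervalIntegrable (fun t => U (γ t + ε • η t)) volume a b :=
      (hU.continuousOn.comp (by fun_prop)
        (hδm ε (Ioo_subset_Icc_self hε))).intervalIntegrable_of_Icc hab
    have h0 := (hint hdq2 hdq2).const_mul (1 / 2)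
    have h1 := (hint hdq2 hv).const_mul ε
    have h2 := ((hint hv hv).const_mul (1 / 2)).const_mul (ε ^ 2)
    rw [← intervalIntegral.integral_const_mul, ← intervalIntegral.integral_const_mul,
      ← intervalIntegral.integral_add h0 h1, ← intervalIntegral.integral_add (h0.add h1) h2,
      ← intervalIntegral.integral_add ((h0.add h1).add h2) hUi]
    refine intervalIntegral_congr_Ioo_ae hab ?_
    filter_upwards [ae_hasDerivAt_of_eq_integral hab hvi hξ] with t ht htI
    have hd : deriv (q + ε • ξ) t = dq t + ε • v t :=
      ((hqd t htI).add ((ht htI).const_smul ε)).deriv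
    rw [hd, hγq t (Ioo_subset_Icc_self htI), hηξ t (Ioo_subset_Icc_self htI)]
    simp only [map_add, map_smul, smul_eq_mul, smul_apply, add_apply, hB (v t) (dq t),
      Pi.add_apply, Pi.smul_apply]
    ring
  rw [iteratedDeriv_succ, iteratedDeriv_one, hev.deriv.deriv_eq]
  have hd1 : deriv (fun ε : ℝ => (A₀ + ε * A₁ + ε ^ 2 * A₂) + ∫ t in a..b, U (γ t + ε • η t))
      =ᶠ[𝓝 0] fun ε => (A₁ + 2 * ε * A₂) + F' ε := by
    filter_upwards [hF'] with ε hε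
    refine HasDerivAt.deriv (HasDerivAt.add ?_ hε)
    have h := (((hasDerivAt_id ε).mul_const A₁).const_add A₀).add
      ((hasDerivAt_pow 2 ε).mul_const A₂)
    exact h.congr_deriv (by simp)
  rw [hd1.deriv_eq]
  have hd2 : HasDerivAt (fun ε : ℝ => (A₁ + 2 * ε * A₂) + F' ε) (2 * A₂ +
      ∫ t in a..b, fderiv ℝ (fderiv ℝ U) (q t) (ξ t) (ξ t)) 0 := by
    refine HasDerivAt.add ?_ hF''
    simpa using (((hasDerivAt_id (0 : ℝ)).const_mul 2).mul_const A₂).const_add A₁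
  rw [hd2.deriv, hA₂, intervalIntegral.integral_const_mul]
  ring

end Action

/-! ### Reduction to the collinear Kepler problem. -/

/-- A positive solution of the collinear Kepler problem `r'' = -u / r²` on `[0, T)` with collapse
at `T`; `p` is the velocity `r'`. -/
structure IsKeplerCollapse (u T : ℝ) (r p : ℝ → ℝ) : Prop where
  coupling_pos : 0 < u
  time_pos : 0 < T
  pos : ∀ t ∈ Ico 0 T, 0 < r t
  continuousOn : ContinuousOn r (Ico 0 T)
  continuousOn_velocity : ContinuousOn p (Ico 0 T)
  hasDerivAt : ∀ t ∈ Ioo 0 T, HasDerivAt r (p t) t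
  hasDerivAt_velocity : ∀ t ∈ Ioo 0 T, HasDerivAt p (-u / r t ^ 2) t
  collapse : Tendsto r (𝓝[<] T) (𝓝 0)

theorem IsKeplerCollapse.energy {u T : ℝ} {r p : ℝ → ℝ} (H : IsKeplerCollapse u T r p) :
    ∃ h : ℝ, ∀ t ∈ Ico 0 T, p t ^ 2 = 2 * h + 2 * u / r t := by
  refine ⟨(p 0 ^ 2 - 2 * u / r 0) / 2, fun t ht => ?_⟩
  rcases eq_or_lt_of_le ht.1 with rfl | h0
  · ring
  have hsub : Icc 0 t ⊆ Ico 0 T := fun x hx => ⟨hx.1, hx.2.trans_lt ht.2⟩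
  obtain ⟨c, hc, hc'⟩ := exists_hasDerivAt_eq_slope (fun s => p s ^ 2 - 2 * u / r s) (fun _ => 0) h0
    (((H.continuousOn_velocity.mono hsub).pow 2).sub
      (continuousOn_const.div (H.continuousOn.mono hsub) fun x hx => (H.pos x (hsub hx)).ne'))
    fun x hx => by
      have hx' : x ∈ Ioo 0 T := ⟨hx.1, hx.2.trans ht.2⟩
      have hr := (H.pos x (Ioo_subset_Ico_self hx')).ne'
      refine (((H.hasDerivAt_velocity x hx').pow 2).sub
        ((hasDerivAt_const x (2 * u)).div (H.hasDerivAt x hx') hr)).congr_deriv ?_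
      field_simp
      ring
  rw [eq_div_iff (by linarith)] at hc'
  linarith

theorem massMap_smul_inner (m : Fin n → ℝ) (c : ℝ) (x y : Config n d) :
    inner ℝ (massMap m (c • x)) y = c * massForm m x y := by
  rw [map_smul, real_inner_smul_left, massForm_apply]

/-- The regularity is that of q, because r = ⟨Ms, q⟩ when s has unit inertia. -/
theorem IsCollidingHomothetic.contDiffOn_radius {m : Fin n → ℝ} {s : Config n d} {T : ℝ}
    {r : ℝ → ℝ} {q : ℝ → Config n d} (H : IsCollidingHomothetic m s T r q)
    (hs : massForm m s s = 1) : ContDiffOn ℝ 2 r (Ico 0 T) :=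
  ((massForm m s).contDiff.comp_contDiffOn H.contDiffOn).congr fun t ht => by
    simp [H.eq_smul t ht, hs]

theorem iteratedDerivWithin_two_smul_const {F : Type*} [NormedAddCommGroup F] [NormedSpace ℝ F]
    {r : ℝ → ℝ} {q : ℝ → F} {s : F} {S : Set ℝ} (hS : UniqueDiffOn ℝ S)
    (hr : ContDiffOn ℝ 2 r S) (hq : ∀ t ∈ S, q t = r t • s) {t : ℝ} (ht : t ∈ S) :
    iteratedDerivWithin 2 q S t = derivWithin (derivWithin r S) S t • s := by
  have h1 : ∀ t ∈ S, derivWithin q S t = derivWithin r S t • s := fun t ht => by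
    rw [derivWithin_congr hq (hq t ht)]
    exact ((hr.differentiableOn (by norm_num) t ht).hasDerivWithinAt.smul_const s).derivWithin
      (hS t ht)
  have hr1 : ContDiffOn ℝ 1 (derivWithin r S) S := hr.derivWithin hS (by norm_num)
  rw [iteratedDerivWithin_succ, iteratedDerivWithin_one, derivWithin_congr h1 (h1 t ht)]
  exact ((hr1.differentiableOn (by norm_num) t ht).hasDerivWithinAt.smul_const s).derivWithin
      (hS t ht)

theorem IsCollidingHomothetic.isKeplerCollapse {m : Fin n → ℝ} (hm : ∀ i, 0 < m i)
    {s : Config n d} (hs : IsCentralConfig m s) {T : ℝ} {r : ℝ → ℝ} {q : ℝ → Config n d}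
    (H : IsCollidingHomothetic m s T r q) :
    IsKeplerCollapse (potential m s) T r (derivWithin r (Ico 0 T)) := by
  have hI : massForm m s s = 1 := hs.1.2
  have hr := H.contDiffOn_radius hI
  have hS : UniqueDiffOn ℝ (Ico 0 T) := uniqueDiffOn_Ico 0 T
  have hr1 : ContDiffOn ℝ 1 (derivWithin r (Ico 0 T)) (Ico 0 T) := hr.derivWithin hS (by norm_num)
  have hnhds : ∀ t ∈ Ioo 0 T, Ico 0 T ∈ 𝓝 t := fun t ht => Ico_mem_nhds ht.1 ht.2
  refine ⟨hs.potential_pos hm, H.time_pos, H.r_pos, hr.continuousOn, hr1.continuousOn,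
    fun t ht => ?_, fun t ht => ?_, ?_⟩
  · exact (hr.differentiableOn (by norm_num) t
      (Ioo_subset_Ico_self ht)).hasDerivWithinAt.hasDerivAt (hnhds t ht)
  · have ht' := Ioo_subset_Ico_self ht
    refine ((hr1.differentiableOn (by norm_num) t ht').hasDerivWithinAt.hasDerivAt
      (hnhds t ht)).congr_deriv ?_
    -- Pairing Newton's equation with s leaves r'' = r⁻² dU(s)[s], and Euler's identity evaluates
    -- dU(s)[s] = −U(s).
    have h := congrArg (fun x => inner ℝ x s) (H.newton t ht')
    simp only [inner_gradient_left, iteratedDerivWithin_two_smul_const hS hr H.eq_smul ht',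
      massMap_smul_inner, hI, H.eq_smul t ht', fderiv_potential_smul m (H.r_pos t ht'),
      smul_apply, fderiv_potential_self m hs.2.1.2] at h
    rw [mul_one] at h
    rw [h, smul_eq_mul]
    have := (H.r_pos t ht').ne'
    field_simp
  · have h : Tendsto (fun t => massForm m s (q t)) (𝓝[<] T) (𝓝 (massForm m s 0)) :=
      ((massForm m s).continuous.tendsto 0).comp H.collapse
    rw [map_zero] at h
    refine h.congr' ?_
    filter_upwards [Ioo_mem_nhdsLT H.time_pos] with t ht
    rw [H.eq_smul t (Ioo_subset_Ico_self ht), map_smul, hI, smul_eq_mul, mul_one]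

theorem contDiffOn_potential (m : Fin n → ℝ) :
    ContDiffOn ℝ 2 (potential (d := d) m) collisionSetᶜ := fun q hq =>
  ((contDiffAt_potential m hq).of_le (by simp)).contDiffWithinAt

/-- The second variation of the action along a homothetic motion. -/
theorem IsCollidingHomothetic.secondVariation_eq {m : Fin n → ℝ} {s : Config n d} {T : ℝ}
    {r : ℝ → ℝ} {q : ℝ → Config n d} (H : IsCollidingHomothetic m s T r q)
    {b : ℝ} (hb : b ∈ Ioo 0 T) {ξ v : ℝ → Config n d}
    (hv : MemLp v 2 (volume.restrict (Icc 0 b))) (hξ : ∀ t ∈ Icc 0 b, ξ t = ∫ τ in 0..t, v τ) :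
    secondVariation m 0 b q ξ = (∫ t in 0..b, massForm m (v t) (v t)) +
      ∫ t in 0..b, (r t ^ 3)⁻¹ * fderiv ℝ (fderiv ℝ (potential m)) s (ξ t) (ξ t) := by
  have hsub : Icc 0 b ⊆ Ico 0 T := fun x hx => ⟨hx.1, hx.2.trans_lt hb.2⟩
  have hq := H.contDiffOn
  refine (iteratedDeriv_two_action (massForm m) (massForm_comm m) isOpen_compl_collisionSet
    (contDiffOn_potential m) hb.1.le (dq := derivWithin q (Ico 0 T)) (hq.continuousOn.mono hsub)
    ((hq.continuousOn_derivWithin (uniqueDiffOn_Ico 0 T) (by norm_num)).mono hsub)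
    (fun t ht => ?_) (fun t ht => (H.mem_collisionFree t (hsub ht)).2) hv hξ).trans ?_
  · exact (hq.differentiableOn (by norm_num) t
      (hsub (Ioo_subset_Icc_self ht))).hasDerivWithinAt.hasDerivAt
      (Ico_mem_nhds ht.1 (ht.2.trans hb.2))
  · congr 1
    refine intervalIntegral_congr_Ioo_ae hb.1.le (Eventually.of_forall fun t ht => ?_)
    have ht' := hsub (Ioo_subset_Icc_self ht)
    rw [H.eq_smul t ht', fderiv_fderiv_potential_smul m (H.r_pos t ht')]
    rfl

/-! ### Hardy inequality and the non-spiral case. -/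

theorem absolutelyContinuousOnInterval_of_hasDerivAt {f f' : ℝ → ℝ} {a b : ℝ} (hab : a ≤ b)
    (hf : ∀ t ∈ Icc a b, HasDerivAt f (f' t) t) (hf' : ContinuousOn f' (Icc a b)) :
    AbsolutelyContinuousOnInterval f a b := by
  obtain ⟨C, hC⟩ := isCompact_Icc.exists_bound_of_continuousOn hf'
  have h : LipschitzOnWith C.toNNReal f (uIcc a b) := by
    rw [uIcc_of_le hab]
    exact (convex_Icc a b).lipschitzOnWith_of_nnnorm_hasDerivWithin_le
      (fun t ht => (hf t ht).hasDerivWithinAt) fun t ht => by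
        rw [← NNReal.coe_le_coe, coe_nnnorm]
        exact (hC t ht).trans (Real.le_coe_toNNReal C)
  exact h.absolutelyContinuousOnInterval

/-- A primitive of a square integrable function is `o(√t)`. -/
theorem sq_integral_le {g : ℝ → ℝ} {b : ℝ} (hb : 0 < b) (hg : IntervalIntegrable g volume 0 b)
    (hg2 : IntervalIntegrable (fun t => g t ^ 2) volume 0 b) :
    (∫ t in 0..b, g t) ^ 2 ≤ b * ∫ t in 0..b, g t ^ 2 := by
  -- The mean of g; the inequality is the nonnegativity of the variance.
  set c := (∫ t in 0..b, g t) / b with hc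
  have h : 0 ≤ ∫ t in 0..b, (g t - c) ^ 2 :=
    intervalIntegral.integral_nonneg hb.le fun t _ => sq_nonneg _
  have h1 : ∫ t in 0..b, (g t - c) ^ 2 = (∫ t in 0..b, g t ^ 2) - 2 * c * (∫ t in 0..b, g t) +
      b * c ^ 2 := by
    have h2 : ∀ t, (g t - c) ^ 2 = g t ^ 2 - 2 * c * g t + c ^ 2 := fun t => by ring
    simp_rw [h2]
    rw [intervalIntegral.integral_add (hg2.sub (hg.const_mul _)) (by simp),
      intervalIntegral.integral_sub hg2 (hg.const_mul _), intervalIntegral.integral_const_mul]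
    simp
  have h3 : ∫ t in 0..b, g t = b * c := by rw [hc]; field_simp
  rw [h1, h3] at h
  rw [h3]
  nlinarith

/-- A Hardy type inequality: if the Riccati inequality `φ' + φ² ≤ -K` has a solution on `(0, b]`,
then the quadratic form `∫ f'² - K f²` is nonnegative on functions vanishing at `0` and `b`. -/
theorem hardy_of_riccati {b C : ℝ} (hb : 0 < b) {φ φ' K g : ℝ → ℝ}
    (hφ : ∀ t ∈ Ioc 0 b, HasDerivAt φ (φ' t) t) (hφ' : ContinuousOn φ' (Ioc 0 b))
    (hK : ContinuousOn K (Icc 0 b)) (hric : ∀ t ∈ Ioc 0 b, φ' t + φ t ^ 2 ≤ -K t)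
    (hC : ∀ t ∈ Ioc 0 b, t * φ t ≤ C)
    (hg : MemLp g 2 (volume.restrict (Icc 0 b))) (hgb : ∫ t in 0..b, g t = 0) :
    0 ≤ ∫ t in 0..b, (g t ^ 2 - K t * (∫ s in 0..t, g s) ^ 2) := by
  set F : ℝ → ℝ := fun t => ∫ s in 0..t, g s with hF
  have hgi : IntervalIntegrable g volume 0 b := intervalIntegrable_of_memLp hb.le hg
  have hg2 : IntervalIntegrable (fun t => g t ^ 2) volume 0 b :=
    (intervalIntegrable_iff_integrableOn_Icc_of_le hb.le).2 hg.integrable_sq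
  have hFc : ContinuousOn F (Icc 0 b) := continuousOn_of_eq_integral hb.le hgi fun t _ => rfl
  have hI : IntervalIntegrable (fun t => g t ^ 2 - K t * F t ^ 2) volume 0 b :=
    hg2.sub ((hK.mul (hFc.pow 2)).intervalIntegrable_of_Icc hb.le)
  set C' := max C 0
  -- φ may be singular at 0, so the argument runs on [ε, b] and ε → 0 at the end.
  have key : ∀ ε ∈ Ioo 0 b, (∫ t in 0..ε, (g t ^ 2 - K t * F t ^ 2)) -
      C' * ∫ t in 0..ε, g t ^ 2 ≤ ∫ t in 0..b, (g t ^ 2 - K t * F t ^ 2) := by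
    intro ε hε
    have hεb : Icc ε b ⊆ Icc 0 b := Icc_subset_Icc_left hε.1.le
    have hεb' : Icc ε b ⊆ Ioc 0 b := fun t ht => ⟨hε.1.trans_le ht.1, ht.2⟩
    have hmono : ∀ {x : ℝ → ℝ}, IntervalIntegrable x volume 0 b →
        IntervalIntegrable x volume ε b := fun hx => hx.mono_set (by
      rw [uIcc_of_le hε.2.le, uIcc_of_le hb.le]; exact hεb)
    have hmono' : ∀ {x : ℝ → ℝ}, IntervalIntegrable x volume 0 b →
        IntervalIntegrable x volume 0 ε := fun hx => hx.mono_set (by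
      rw [uIcc_of_le hε.1.le, uIcc_of_le hb.le]; exact Icc_subset_Icc_right hε.2.le)
    have hFac : AbsolutelyContinuousOnInterval F ε b :=
      (hgi.absolutelyContinuousOnInterval_intervalIntegral left_mem_uIcc).mono (by
        rw [uIcc_of_le hε.2.le, uIcc_of_le hb.le]; exact hεb)
    have hφac := absolutelyContinuousOnInterval_of_hasDerivAt hε.2.le
      (fun t ht => hφ t (hεb' ht)) (hφ'.mono hεb')
    have hφc : ContinuousOn φ (Icc ε b) := fun t ht =>
      (hφ t (hεb' ht)).continuousAt.continuousWithinAt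
    have hFTC : ∫ t in ε..b, (φ' t * F t ^ 2 + φ t * (2 * F t * g t)) = -(φ ε * F ε ^ 2) := by
      have h := (hφac.fun_mul (hFac.fun_mul hFac)).integral_deriv_eq_sub
      have hFb : F b = 0 := hgb
      rw [hFb, mul_zero, mul_zero, zero_sub, ← sq] at h
      rw [← h]
      refine intervalIntegral_congr_Ioo_ae hε.2.le ?_
      filter_upwards [ae_hasDerivAt_of_eq_integral (ξ := F) hb.le hgi fun t _ => rfl] with t ht htI
      have ht' := ht ⟨hε.1.trans htI.1, htI.2⟩
      rw [((hφ t (hεb' (Ioo_subset_Icc_self htI))).fun_mul (ht'.fun_mul ht')).deriv]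
      ring
    have hFg : IntervalIntegrable (fun t => φ' t * F t ^ 2 + φ t * (2 * F t * g t))
        volume ε b := by
      refine (((hφ'.mono hεb').mul ((hFc.mono hεb).pow 2)).intervalIntegrable_of_Icc
        hε.2.le).add ?_
      have h := (hmono hgi).continuousOn_mul (g := fun t => φ t * (2 * F t)) (by
        rw [uIcc_of_le hε.2.le]
        exact hφc.mul ((hFc.mono hεb).const_mul 2))
      exact h.congr fun t _ => by ring
    -- By the Riccati inequality, g² − KF² − (φF²)' ≥ (g − φF)² ≥ 0.
    have hge : -(φ ε * F ε ^ 2) ≤ ∫ t in ε..b, (g t ^ 2 - K t * F t ^ 2) := by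
      rw [← hFTC]
      refine intervalIntegral.integral_mono_on hε.2.le hFg (hmono hI) fun t ht => ?_
      nlinarith [sq_nonneg (g t - φ t * F t),
        mul_le_mul_of_nonneg_right (hric t (hεb' ht)) (sq_nonneg (F t))]
    have hsq : F ε ^ 2 ≤ ε * ∫ t in 0..ε, g t ^ 2 :=
      sq_integral_le hε.1 (hmono' hgi) (hmono' hg2)
    have hg0 : 0 ≤ ∫ t in 0..ε, g t ^ 2 :=
      intervalIntegral.integral_nonneg hε.1.le fun t _ => sq_nonneg _
    have hend : φ ε * F ε ^ 2 ≤ C' * ∫ t in 0..ε, g t ^ 2 := by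
      rcases le_total 0 (φ ε) with h0 | h0
      · calc φ ε * F ε ^ 2 ≤ φ ε * (ε * ∫ t in 0..ε, g t ^ 2) :=
              mul_le_mul_of_nonneg_left hsq h0
          _ = (ε * φ ε) * ∫ t in 0..ε, g t ^ 2 := by ring
          _ ≤ C' * ∫ t in 0..ε, g t ^ 2 := mul_le_mul_of_nonneg_right
              ((hC ε ⟨hε.1, hε.2.le⟩).trans (le_max_left _ _)) hg0
      · exact (mul_nonpos_of_nonpos_of_nonneg h0 (sq_nonneg _)).trans
          (mul_nonneg (le_max_right _ _) hg0)
    rw [← intervalIntegral.integral_add_adjacent_intervals (hmono' hI) (hmono hI)]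
    linarith
  have hlim : ContinuousWithinAt (fun ε => (∫ t in 0..ε, (g t ^ 2 - K t * F t ^ 2)) -
      C' * ∫ t in 0..ε, g t ^ 2) (Icc 0 b) 0 :=
    ((continuousOn_of_eq_integral hb.le hI fun t _ => rfl).sub
      ((continuousOn_of_eq_integral hb.le hg2 fun t _ => rfl).const_mul C')) 0
        (left_mem_Icc.2 hb.le)
  have hlim' := hlim.tendsto.mono_left (nhdsWithin_mono 0 (Ioo_subset_Icc_self (a := 0) (b := b)))
  simp only [intervalIntegral.integral_same, mul_zero, sub_zero] at hlim'
  have : (𝓝[Ioo 0 b] (0 : ℝ)).NeBot := left_nhdsWithin_Ioo_neBot hb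
  exact le_of_tendsto hlim' (eventually_nhdsWithin_of_forall key)

/-- The Riccati inequality along a collapsing Kepler motion which is not expanding initially. -/
theorem IsKeplerCollapse.exists_riccati {u T : ℝ} {r p : ℝ → ℝ} (H : IsKeplerCollapse u T r p)
    (hp0 : p 0 ≤ 0) {b : ℝ} (hb : b ∈ Ioo 0 T) :
    ∃ (C : ℝ) (φ φ' : ℝ → ℝ), (∀ t ∈ Ioc 0 b, HasDerivAt φ (φ' t) t) ∧
      ContinuousOn φ' (Ioc 0 b) ∧
      (∀ t ∈ Ioc 0 b, φ' t + φ t ^ 2 ≤ -(9 / 8 * u * (r t ^ 3)⁻¹)) ∧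
      ∀ t ∈ Ioc 0 b, t * φ t ≤ C := by
  obtain ⟨h, hE⟩ := H.energy
  have hu := H.coupling_pos
  have hIoo : Ioc 0 b ⊆ Ioo 0 T := fun t ht => ⟨ht.1, ht.2.trans_lt hb.2⟩
  have hIco : Icc 0 b ⊆ Ico 0 T := fun t ht => ⟨ht.1, ht.2.trans_lt hb.2⟩
  have hIoc : Ioc 0 b ⊆ Ico 0 T := hIoo.trans Ioo_subset_Ico_self
  have hrc := H.continuousOn.mono hIoc
  have hpc := H.continuousOn_velocity.mono hIoc
  have hr0 : ∀ t ∈ Ioc 0 b, r t ≠ 0 := fun t ht => (H.pos t (hIoc ht)).ne'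
  rcases le_total 0 h with hh | hh
  -- Nonnegative energy: φ is the logarithmic derivative of r^(3/4), and the Riccati inequality has
  -- the slack (3/8)h/r².
  · obtain ⟨B, hB⟩ := isCompact_Icc.exists_bound_of_continuousOn
      (f := fun t => t * (3 / 4 * (p t / r t))) (continuousOn_id.mul (continuousOn_const.mul
      ((H.continuousOn_velocity.mono hIco).div (H.continuousOn.mono hIco)
        fun t ht => (H.pos t (hIco ht)).ne')))
    refine ⟨B, fun t => 3 / 4 * (p t / r t),
      fun t => 3 / 4 * ((-u / r t ^ 2 * r t - p t * p t) / r t ^ 2), fun t ht => ?_, ?_,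
      fun t ht => ?_, fun t ht => (le_abs_self _).trans (hB t (Ioc_subset_Icc_self ht))⟩
    · exact ((H.hasDerivAt_velocity t (hIoo ht)).div (H.hasDerivAt t (hIoo ht))
        (hr0 t ht)).const_mul _
    · have h2 : ∀ t ∈ Ioc 0 b, r t ^ 2 ≠ 0 := fun t ht => pow_ne_zero 2 (hr0 t ht)
      fun_prop (disch := assumption)
    · have hr := H.pos t (hIoc ht)
      have hEt := hE t (hIoc ht)
      have hle : 0 ≤ 3 / 8 * h / r t ^ 2 := by positivity
      have : 3 / 4 * ((-u / r t ^ 2 * r t - p t * p t) / r t ^ 2) + (3 / 4 * (p t / r t)) ^ 2 =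
          -(9 / 8 * u * (r t ^ 3)⁻¹) - 3 / 8 * h / r t ^ 2 := by
        have : 3 / 4 * ((-u / r t ^ 2 * r t - p t * p t) / r t ^ 2) + (3 / 4 * (p t / r t)) ^ 2 =
          -3 / 4 * u / r t ^ 3 - 3 / 16 * p t ^ 2 / r t ^ 2 := by field_simp; ring
        rw [this, hEt]
        field_simp
        ring
      linarith
  · obtain ⟨R, hR⟩ := isCompact_Icc.exists_bound_of_continuousOn (H.continuousOn.mono hIco)
    have hRr : ∀ t ∈ Icc 0 b, r t ≤ R := fun t ht => (le_abs_self _).trans (hR t ht)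
    have hR0 : 0 < R := (H.pos 0 ⟨le_rfl, H.time_pos⟩).trans_le (hRr 0 ⟨le_rfl, hb.1.le⟩)
    -- Since r' starts nonpositive and r'' ≤ −u/R², r' is negative for t > 0. The linear rate bounds
    -- t φ(t) even when r'(0) = 0 makes φ blow up at 0.
    have hp : ∀ t ∈ Ioc 0 b, u / R ^ 2 * t ≤ -p t := by
      intro t ht
      have hsub : Icc 0 t ⊆ Icc 0 b := Icc_subset_Icc_right ht.2
      obtain ⟨c, hc, hc'⟩ := exists_hasDerivAt_eq_slope p (fun t => -u / r t ^ 2) ht.1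
        (H.continuousOn_velocity.mono (hsub.trans hIco)) fun x hx =>
          H.hasDerivAt_velocity x ⟨hx.1, hx.2.trans (hIoo ht).2⟩
      have hcI := hsub (Ioo_subset_Icc_self hc)
      have hrc0 := H.pos c (hIco hcI)
      have hle : u / R ^ 2 ≤ u / r c ^ 2 := by gcongr; exact hRr c hcI
      rw [eq_div_iff (by linarith [ht.1]), neg_div] at hc'
      nlinarith [ht.1]
    have hp' : ∀ t ∈ Ioc 0 b, p t < 0 := fun t ht => by
      have : 0 < u / R ^ 2 * t := mul_pos (by positivity) ht.1
      linarith [hp t ht]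
    have hpr : ∀ t ∈ Ioc 0 b, r t ^ 2 * p t ≠ 0 := fun t ht =>
      mul_ne_zero (pow_ne_zero 2 (hr0 t ht)) (hp' t ht).ne
    -- the logarithmic derivative of `r ^ (5 / 4) * |r'|`
    set φ : ℝ → ℝ := fun t => 5 / 4 * (p t / r t) - u / (r t ^ 2 * p t) with hφ
    obtain ⟨B, hB⟩ := isCompact_Icc.exists_bound_of_continuousOn
      (f := fun t => t * (5 / 4 * (p t / r t))) (continuousOn_id.mul (continuousOn_const.mul
      ((H.continuousOn_velocity.mono hIco).div (H.continuousOn.mono hIco)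
        fun t ht => (H.pos t (hIco ht)).ne')))
    obtain ⟨D, hD⟩ := isCompact_Icc.exists_bound_of_continuousOn
      (f := fun t => R ^ 2 / r t ^ 2) (continuousOn_const.div ((H.continuousOn.mono hIco).pow 2)
        fun t ht => pow_ne_zero 2 (H.pos t (hIco ht)).ne')
    refine ⟨B + D, φ, fun t => 5 / 4 * ((-u / r t ^ 2 * r t - p t * p t) / r t ^ 2) +
      u * (2 * r t * p t * p t + r t ^ 2 * (-u / r t ^ 2)) / (r t ^ 2 * p t) ^ 2,
      fun t ht => ?_, ?_, fun t ht => ?_, fun t ht => ?_⟩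
    · have h1 := H.hasDerivAt t (hIoo ht)
      have h2 := H.hasDerivAt_velocity t (hIoo ht)
      have h3 := ((h2.div h1 (hr0 t ht)).const_mul (5 / 4)).sub
        ((hasDerivAt_const t u).div ((h1.pow 2).mul h2) (hpr t ht))
      refine h3.congr_deriv ?_
      simp only [Pi.mul_apply, Pi.pow_apply]
      ring
    · have h2 : ∀ t ∈ Ioc 0 b, r t ^ 2 ≠ 0 := fun t ht => pow_ne_zero 2 (hr0 t ht)
      have h3 : ∀ t ∈ Ioc 0 b, (r t ^ 2 * p t) ^ 2 ≠ 0 := fun t ht => pow_ne_zero 2 (hpr t ht)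
      fun_prop (disch := assumption)
    · have hr := H.pos t (hIoc ht)
      have hpt := (hp' t ht).ne
      have hEt := hE t (hIoc ht)
      have hle : 5 / 8 * h / r t ^ 2 ≤ 0 :=
        div_nonpos_of_nonpos_of_nonneg (by linarith) (sq_nonneg _)
      have : 5 / 4 * ((-u / r t ^ 2 * r t - p t * p t) / r t ^ 2) +
          u * (2 * r t * p t * p t + r t ^ 2 * (-u / r t ^ 2)) / (r t ^ 2 * p t) ^ 2 + φ t ^ 2 =
          -(9 / 8 * u * (r t ^ 3)⁻¹) + 5 / 8 * h / r t ^ 2 := by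
        have : 5 / 4 * ((-u / r t ^ 2 * r t - p t * p t) / r t ^ 2) +
          u * (2 * r t * p t * p t + r t ^ 2 * (-u / r t ^ 2)) / (r t ^ 2 * p t) ^ 2 + φ t ^ 2 =
          -7 / 4 * u / r t ^ 3 + 5 / 16 * p t ^ 2 / r t ^ 2 := by
          simp only [hφ]; field_simp; ring
        rw [this, hEt]
        field_simp
        ring
      linarith
    · have h1 := (le_abs_self _).trans (hB t (Ioc_subset_Icc_self ht))
      have h2 := (le_abs_self _).trans (hD t (Ioc_subset_Icc_self ht))
      have hr := H.pos t (hIoc ht)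
      have h3 : t * (-(u / (r t ^ 2 * p t))) ≤ R ^ 2 / r t ^ 2 := by
        have hpn : 0 < -p t := by linarith [hp' t ht]
        have : t * (-(u / (r t ^ 2 * p t))) = (u * t) / (r t ^ 2 * -p t) := by
          rw [mul_neg (r t ^ 2), div_neg]; ring
        rw [this, div_le_div_iff₀ (by positivity) (by positivity)]
        have h4 := hp t ht
        rw [div_mul_eq_mul_div, div_le_iff₀ (by positivity)] at h4
        nlinarith [sq_nonneg (r t)]
      simp only [hφ, mul_sub]
      linarith

/-- Replacing D²U(s) by its lower bound −(9U/8)M leaves a form that is diagonal in the Euclidean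
coordinates, and `hardy_of_riccati` applies to each coordinate. -/
theorem secondVariation_nonneg {m : Fin n → ℝ} (hm : ∀ i, 0 < m i)
    {s : Config n d} (hs : IsCentralConfig m s) (hns : IsNonSpiral m s) {T : ℝ} {r : ℝ → ℝ}
    {q : ℝ → Config n d} (H : IsCollidingHomothetic m s T r q)
    (hr0 : derivWithin r (Ico 0 T) 0 ≤ 0) {b : ℝ} (hb : b ∈ Ioo 0 T) {ξ : ℝ → Config n d}
    (hξ : ξ ∈ sobolevZero m 0 b) : 0 ≤ secondVariation m 0 b q ξ := by
  obtain ⟨hX, hout, v, hv, hξv⟩ := hξ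
  have hK := H.isKeplerCollapse hm hs
  obtain ⟨C, φ, φ', hφ, hφ', hric, hC⟩ := hK.exists_riccati hr0 hb
  set u := potential m s
  have hIco : Icc 0 b ⊆ Ico 0 T := fun t ht => ⟨ht.1, ht.2.trans_lt hb.2⟩
  have hvi := intervalIntegrable_of_memLp hb.1.le hv
  have hξc := continuousOn_of_eq_integral hb.1.le hvi hξv
  have hr3 : ContinuousOn (fun t => (r t ^ 3)⁻¹) (Icc 0 b) :=
    ((hK.continuousOn.mono hIco).pow 3).inv₀ fun t ht => pow_ne_zero 3 (hK.pos t (hIco ht)).ne'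
  have hKc : ContinuousOn (fun t => 9 / 8 * u * (r t ^ 3)⁻¹) (Icc 0 b) := hr3.const_mul _
  rw [H.secondVariation_eq hb hv hξv]
  have hvv : IntervalIntegrable (fun t => massForm m (v t) (v t)) volume 0 b :=
    (intervalIntegrable_iff_integrableOn_Icc_of_le hb.1.le).2 (integrable_bilin _ hv hv)
  have hξξ : ContinuousOn (fun t => 9 / 8 * u * (r t ^ 3)⁻¹ * massForm m (ξ t) (ξ t)) (Icc 0 b) :=
    hKc.mul (((massForm m).continuous.comp_continuousOn hξc).clm_apply hξc)
  have hlow : ∫ t in 0..b, -(9 / 8 * u * (r t ^ 3)⁻¹ * massForm m (ξ t) (ξ t)) ≤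
      ∫ t in 0..b, (r t ^ 3)⁻¹ * fderiv ℝ (fderiv ℝ (potential m)) s (ξ t) (ξ t) := by
    refine intervalIntegral.integral_mono_on hb.1.le (hξξ.neg.intervalIntegrable_of_Icc hb.1.le)
      ((hr3.mul (((fderiv ℝ (fderiv ℝ (potential m)) s).continuous.comp_continuousOn
        hξc).clm_apply hξc)).intervalIntegrable_of_Icc hb.1.le) fun t ht => ?_
    have h1 := hns.hessian_ge hm hs (hX t)
    have h2 : 0 ≤ (r t ^ 3)⁻¹ := inv_nonneg.2 (pow_nonneg (hK.pos t (hIco ht)).le 3)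
    have h3 := mul_le_mul_of_nonneg_left h1 h2
    rw [← massForm_apply] at h3
    refine le_trans (le_of_eq ?_) h3
    ring
  refine le_trans ?_ (add_le_add_right hlow _)
  have hξi : IntervalIntegrable (fun t => -(9 / 8 * u * (r t ^ 3)⁻¹ * massForm m (ξ t) (ξ t)))
      volume 0 b := hξξ.neg.intervalIntegrable_of_Icc hb.1.le
  rw [← intervalIntegral.integral_add hvv hξi]
  have hcoord : ∀ i k, MemLp (fun t => v t i k) 2 (volume.restrict (Icc 0 b)) := fun i k =>
    ((EuclideanSpace.proj (𝕜 := ℝ) k).comp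
      (PiLp.proj (𝕜 := ℝ) 2 (fun _ : Fin n => EuclideanSpace ℝ (Fin d)) i)).comp_memLp' hv
  have hξcoord : ∀ i k, ∀ t ∈ Icc 0 b, ξ t i k = ∫ τ in 0..t, v τ i k := fun i k t ht => by
    rw [hξv t ht]
    exact (((EuclideanSpace.proj (𝕜 := ℝ) k).comp (PiLp.proj (𝕜 := ℝ) 2
      (fun _ : Fin n => EuclideanSpace ℝ (Fin d)) i)).intervalIntegral_comp_comm
      (hvi.mono_set (by
        rw [uIcc_of_le ht.1, uIcc_of_le hb.1.le]; exact Icc_subset_Icc_right ht.2))).symm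
  have hint : ∀ i k, IntervalIntegrable (fun t => m i * (v t i k ^ 2 - 9 / 8 * u * (r t ^ 3)⁻¹ *
      (∫ τ in 0..t, v τ i k) ^ 2)) volume 0 b := fun i k => by
    refine IntervalIntegrable.const_mul (.sub ?_ ?_) _
    · exact (intervalIntegrable_iff_integrableOn_Icc_of_le hb.1.le).2 (hcoord i k).integrable_sq
    · exact (hKc.mul ((continuousOn_of_eq_integral hb.1.le
        (intervalIntegrable_of_memLp hb.1.le (hcoord i k))
        fun t _ => rfl).pow 2)).intervalIntegrable_of_Icc hb.1.le
  have hsum : ∫ t in 0..b, (massForm m (v t) (v t) +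
      -(9 / 8 * u * (r t ^ 3)⁻¹ * massForm m (ξ t) (ξ t))) =
      ∫ t in 0..b, ∑ i, ∑ k, m i * (v t i k ^ 2 - 9 / 8 * u * (r t ^ 3)⁻¹ *
        (∫ τ in 0..t, v τ i k) ^ 2) := by
    refine intervalIntegral_congr_Ioo_ae hb.1.le (Eventually.of_forall fun t ht => ?_)
    simp only [massForm_apply, inner_massMap_eq_sum_coord, Finset.mul_sum,
      ← Finset.sum_neg_distrib, ← Finset.sum_add_distrib,
      hξcoord _ _ t (Ioo_subset_Icc_self ht)]
    exact Finset.sum_congr rfl fun i _ => Finset.sum_congr rfl fun k _ => by ring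
  have hξb : ξ b = 0 := hout b fun h => lt_irrefl _ h.2
  have hint' : ∀ i, IntervalIntegrable (fun t => ∑ k, m i * (v t i k ^ 2 -
      9 / 8 * u * (r t ^ 3)⁻¹ * (∫ τ in 0..t, v τ i k) ^ 2)) volume 0 b := fun i =>
    (IntervalIntegrable.sum Finset.univ fun k _ => hint i k).congr fun t _ =>
      Finset.sum_apply t _ _
  rw [hsum, intervalIntegral.integral_finsetSum fun i _ => hint' i]
  refine Finset.sum_nonneg fun i _ => ?_
  rw [intervalIntegral.integral_finsetSum fun k _ => hint i k]
  refine Finset.sum_nonneg fun k _ => ?_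
  rw [intervalIntegral.integral_const_mul]
  refine mul_nonneg (hm i).le (hardy_of_riccati hb.1 hφ hφ' hKc hric hC (hcoord i k) ?_)
  rw [← hξcoord i k b ⟨hb.1.le, le_rfl⟩, hξb]
  simp

theorem hasMorseIndex_zero {m : Fin n → ℝ} (hm : ∀ i, 0 < m i)
    {s : Config n d} (hs : IsCentralConfig m s) (hns : IsNonSpiral m s) {T : ℝ} {r : ℝ → ℝ}
    {q : ℝ → Config n d} (H : IsCollidingHomothetic m s T r q)
    (hr0 : derivWithin r (Ico 0 T) 0 ≤ 0) : HasMorseIndex m T q 0 := by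
  intro t ht _
  have h : ∀ j, morseIndex m 0 (t j) q = 0 := by
    intro j
    rw [morseIndex, ← nonpos_iff_eq_zero]
    refine iSup₂_le fun V hV => ?_
    have hbot : V = ⊥ := (Submodule.eq_bot_iff V).2 fun ξ hξ => by
      by_contra h0
      exact absurd (hV.2 ξ hξ h0)
        (not_lt.2 (secondVariation_nonneg hm hs hns H hr0 (ht j) (hV.1 hξ)))
    rw [hbot]
    simp
  simp only [h]
  exact tendsto_const_nhds

/-! ### Oscillation near the collapse and the spiral case. -/

/-- Near the collapse, `r³ ≤ (9u/2 + δ) (T - t)²`. -/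
theorem IsKeplerCollapse.cube_le {u T : ℝ} {r p : ℝ → ℝ} (H : IsKeplerCollapse u T r p)
    {δ : ℝ} (hδ : 0 < δ) :
    ∃ t₀ ∈ Ico 0 T, ∀ t ∈ Ioo t₀ T, r t ^ 3 ≤ (9 / 2 * u + δ) * (T - t) ^ 2 := by
  obtain ⟨h, hE⟩ := H.energy
  have hu := H.coupling_pos
  set A := 9 / 2 * u + δ with hA
  have hA0 : 0 < A := by positivity
  have hlim : Tendsto (fun t => 9 / 4 * (2 * h * r t + 2 * u)) (𝓝[<] T)
      (𝓝 (9 / 4 * (2 * h * 0 + 2 * u))) :=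
    ((H.collapse.const_mul (2 * h)).add_const _).const_mul _
  have hev : ∀ᶠ t in 𝓝[<] T, 9 / 4 * (2 * h * r t + 2 * u) < A :=
    hlim.eventually (gt_mem_nhds (by rw [hA]; linarith))
  obtain ⟨t₁, ht₁, ht₁'⟩ := (mem_nhdsLT_iff_exists_Ioo_subset' H.time_pos).1 hev
  refine ⟨max 0 t₁, ⟨le_max_left _ _, max_lt H.time_pos ht₁⟩, fun t ht => ?_⟩
  have ht0 : 0 < t := (le_max_left _ _).trans_lt ht.1
  have ht1 : t₁ < t := (le_max_right _ _).trans_lt ht.1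
  have hrt := H.pos t ⟨ht0.le, ht.2⟩
  -- By the energy identity the squared derivative of r^(3/2) is (9/4)(2hr + 2u), which tends to
  -- 9u/2. The mean value theorem is used up to s < T, and then s → T.
  have hlip : ∀ s ∈ Ioo t T, r t ^ (3 / 2 : ℝ) ≤ √A * (T - t) + r s ^ (3 / 2 : ℝ) := by
    intro s hs
    have hIoo : ∀ x ∈ Icc t s, x ∈ Ioo 0 T := fun x hx =>
      ⟨ht0.trans_le hx.1, hx.2.trans_lt hs.2⟩
    have hd : ∀ x ∈ Icc t s, HasDerivAt (fun x => r x ^ (3 / 2 : ℝ))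
        (p x * (3 / 2) * r x ^ ((3 / 2 : ℝ) - 1)) x := fun x hx =>
      (H.hasDerivAt x (hIoo x hx)).rpow_const
        (Or.inl (H.pos x (Ioo_subset_Ico_self (hIoo x hx))).ne')
    obtain ⟨c, hc, hc'⟩ := exists_hasDerivAt_eq_slope _ _ hs.1
      (fun x hx => (hd x hx).continuousAt.continuousWithinAt)
      (fun x hx => hd x (Ioo_subset_Icc_self hx))
    have hcI := hIoo c (Ioo_subset_Icc_self hc)
    have hrc := H.pos c (Ioo_subset_Ico_self hcI)
    have hsq : (p c * (3 / 2) * r c ^ ((3 / 2 : ℝ) - 1)) ^ 2 ≤ A := by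
      have h1 : (r c ^ ((3 / 2 : ℝ) - 1)) ^ 2 = r c := by
        rw [← Real.rpow_natCast, ← Real.rpow_mul hrc.le]; norm_num
      have h2 := ht₁' (show c ∈ Ioo t₁ T from ⟨ht1.trans hc.1, hcI.2⟩)
      simp only [mem_ofPred_eq] at h2
      rw [mul_pow, h1, mul_pow, hE c (Ioo_subset_Ico_self hcI)]
      refine le_trans (le_of_eq ?_) h2.le
      field_simp
      ring
    have habs := Real.abs_le_sqrt hsq
    rw [hc', abs_le] at habs
    have h3 := habs.1
    rw [le_div_iff₀ (by linarith [hs.1])] at h3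
    have h4 : √A * (s - t) ≤ √A * (T - t) :=
      mul_le_mul_of_nonneg_left (by linarith [hs.2]) (Real.sqrt_nonneg A)
    linarith
  have hlim2 : Tendsto (fun s => √A * (T - t) + r s ^ (3 / 2 : ℝ)) (𝓝[<] T)
      (𝓝 (√A * (T - t) + 0)) := by
    refine Tendsto.const_add _ ?_
    have := H.collapse.rpow_const (p := 3 / 2) (Or.inr (by norm_num))
    rwa [Real.zero_rpow (by norm_num)] at this
  have hle : r t ^ (3 / 2 : ℝ) ≤ √A * (T - t) := by
    have h5 := ge_of_tendsto hlim2
      (by filter_upwards [Ioo_mem_nhdsLT ht.2] with s hs using hlip s hs)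
    rwa [add_zero] at h5
  have h6 : (r t ^ (3 / 2 : ℝ)) ^ 2 = r t ^ 3 := by
    rw [← Real.rpow_natCast, ← Real.rpow_mul hrt.le, ← Real.rpow_natCast]; norm_num
  rw [← h6, ← Real.sq_sqrt hA0.le, ← mul_pow]
  exact pow_le_pow_left₀ (Real.rpow_nonneg hrt.le _) hle 2

/-- The function is the imaginary part of (T−t)^(1/2+iβ), a solution of the Euler equation G'' =
−(1/4+β²)(T−t)⁻² G. -/
theorem hasDerivAt_oscillating (T β : ℝ) {t : ℝ} (ht : t < T) :
    HasDerivAt (fun t => √(T - t) * Real.sin (β * Real.log (T - t)))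
      (-(1 / 2 * Real.sin (β * Real.log (T - t)) + β * Real.cos (β * Real.log (T - t))) /
        √(T - t)) t := by
  have hx : 0 < T - t := sub_pos.2 ht
  have h0 : HasDerivAt (fun t => T - t) (-1) t := by simpa using (hasDerivAt_id t).const_sub T
  have h1 := h0.sqrt hx.ne'
  have h2 := ((h0.log hx.ne').const_mul β).sin
  refine (h1.mul h2).congr_deriv ?_
  have hs : 0 < √(T - t) := Real.sqrt_pos.2 hx
  have hss : T - t = √(T - t) ^ 2 := (Real.sq_sqrt hx.le).symm
  generalize Real.sin (β * Real.log (T - t)) = S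
  generalize Real.cos (β * Real.log (T - t)) = C
  generalize √(T - t) = y at hs hss ⊢
  rw [hss]
  field_simp
  ring

theorem hasDerivAt_oscillating_deriv (T β : ℝ) {t : ℝ} (ht : t < T) :
    HasDerivAt (fun t => -(1 / 2 * Real.sin (β * Real.log (T - t)) +
        β * Real.cos (β * Real.log (T - t))) / √(T - t))
      (-((1 / 4 + β ^ 2) / (T - t) ^ 2 * (√(T - t) * Real.sin (β * Real.log (T - t))))) t := by
  have hx : 0 < T - t := sub_pos.2 ht
  have h0 : HasDerivAt (fun t => T - t) (-1) t := by simpa using (hasDerivAt_id t).const_sub T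
  have h1 := h0.sqrt hx.ne'
  have h2 := ((h0.log hx.ne').const_mul β)
  have hs : 0 < √(T - t) := Real.sqrt_pos.2 hx
  refine (((h2.sin.const_mul (1 / 2)).add (h2.cos.const_mul β)).neg.div h1 hs.ne').congr_deriv ?_
  have hss : T - t = √(T - t) ^ 2 := (Real.sq_sqrt hx.le).symm
  simp only [Pi.neg_apply, Pi.add_apply]
  generalize Real.sin (β * Real.log (T - t)) = S
  generalize Real.cos (β * Real.log (T - t)) = C
  generalize √(T - t) = y at hs hss ⊢
  rw [hss]
  field_simp
  ring

/-- The index form is negative on an arc of a solution of the comparison equation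
`G'' = -W G` with `W < K`. -/
theorem integral_neg_of_comparison {a b : ℝ} (hab : a < b) {G G' W K : ℝ → ℝ}
    (hG : ∀ t ∈ Icc a b, HasDerivAt G (G' t) t)
    (hG' : ∀ t ∈ Icc a b, HasDerivAt G' (-(W t * G t)) t)
    (hK : ContinuousOn K (Icc a b)) (hW : ContinuousOn W (Icc a b))
    (hWK : ∀ t ∈ Icc a b, W t < K t) (ha : G a = 0) (hb : G b = 0)
    (hne : ∀ t ∈ Ioo a b, G t ≠ 0) :
    (∫ t in a..b, G' t ^ 2) - ∫ t in a..b, K t * G t ^ 2 < 0 := by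
  have hGc : ContinuousOn G (Icc a b) := fun t ht => (hG t ht).continuousAt.continuousWithinAt
  have hG'c : ContinuousOn G' (Icc a b) := fun t ht => (hG' t ht).continuousAt.continuousWithinAt
  have hi : ∀ {f : ℝ → ℝ}, ContinuousOn f (Icc a b) → IntervalIntegrable f volume a b :=
    fun hf => hf.intervalIntegrable_of_Icc hab.le
  -- Integrating (GG')' gives ∫ G'² = ∫ W G², so the form equals −∫ (K − W) G².
  have h1 : ∫ t in a..b, (G' t * G' t + G t * -(W t * G t)) = G b * G' b - G a * G' a := by
    refine intervalIntegral.integral_eq_sub_of_hasDerivAt (f := fun t => G t * G' t)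
      (fun t ht => ?_) (hi ((hG'c.mul hG'c).add (hGc.mul (hW.mul hGc).neg)))
    rw [uIcc_of_le hab.le] at ht
    exact (hG t ht).mul (hG' t ht)
  have h2 : 0 < ∫ t in a..b, (K t - W t) * G t ^ 2 :=
    intervalIntegral.intervalIntegral_pos_of_pos_on (hi ((hK.sub hW).mul (hGc.pow 2)))
      (fun t ht => mul_pos (sub_pos.2 (hWK t (Ioo_subset_Icc_self ht)))
        (sq_pos_of_ne_zero (hne t ht))) hab
  rw [ha, hb, zero_mul, zero_mul, sub_zero] at h1
  have h3 : (∫ t in a..b, G' t ^ 2) - ∫ t in a..b, K t * G t ^ 2 =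
      (∫ t in a..b, (G' t * G' t + G t * -(W t * G t))) - ∫ t in a..b, (K t - W t) * G t ^ 2 := by
    have i1 : IntervalIntegrable (fun t => G' t ^ 2) volume a b := hi (hG'c.pow 2)
    have i2 : IntervalIntegrable (fun t => K t * G t ^ 2) volume a b := hi (hK.mul (hGc.pow 2))
    have i3 : IntervalIntegrable (fun t => G' t * G' t + G t * -(W t * G t)) volume a b :=
      hi ((hG'c.mul hG'c).add (hGc.mul (hW.mul hGc).neg))
    have i4 : IntervalIntegrable (fun t => (K t - W t) * G t ^ 2) volume a b :=
      hi ((hK.sub hW).mul (hGc.pow 2))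
    rw [← intervalIntegral.integral_sub i1 i2, ← intervalIntegral.integral_sub i3 i4]
    exact intervalIntegral.integral_congr fun t _ => by ring
  linarith

theorem integral_indicator_Ioc {a b c : ℝ} (ha : 0 ≤ a) (hab : a ≤ b) (hbc : b ≤ c) (f : ℝ → ℝ) :
    ∫ t in 0..c, (Ioc a b).indicator f t = ∫ t in a..b, f t := by
  rw [intervalIntegral.integral_of_le (ha.trans (hab.trans hbc)),
    setIntegral_indicator measurableSet_Ioc, Ioc_inter_Ioc, max_eq_right ha, min_eq_right hbc,
    intervalIntegral.integral_of_le hab]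

/-- A function on `[a, b]` vanishing at both ends, extended by zero, is a primitive of the
extension by zero of its derivative. -/
theorem integral_indicator_deriv {a b t : ℝ} (ha : 0 ≤ a) (hab : a ≤ b) (ht : 0 ≤ t)
    {G G' : ℝ → ℝ} (hG : ∀ t ∈ Icc a b, HasDerivAt G (G' t) t) (hG' : ContinuousOn G' (Icc a b))
    (hGa : G a = 0) (hGb : G b = 0) :
    ∫ s in 0..t, (Ioc a b).indicator G' s = (Ioc a b).indicator G t := by
  rw [intervalIntegral.integral_of_le ht, setIntegral_indicator measurableSet_Ioc,
    Ioc_inter_Ioc, max_eq_right ha]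
  rcases le_or_gt t a with hta | hta
  · rw [Ioc_eq_empty (not_lt.2 ((min_le_left t b).trans hta)),
      indicator_of_notMem fun h => absurd h.1 (not_lt.2 hta)]
    simp
  · have hmin : a ≤ min t b := le_min hta.le hab
    rw [← intervalIntegral.integral_of_le hmin,
      intervalIntegral.integral_eq_sub_of_hasDerivAt (f := G) (fun s hs => by
        rw [uIcc_of_le hmin] at hs
        exact hG s ⟨hs.1, hs.2.trans (min_le_right _ _)⟩)
        ((hG'.mono (Icc_subset_Icc_right (min_le_right _ _))).intervalIntegrable_of_Icc hmin),
      hGa, sub_zero]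
    rcases le_or_gt t b with htb | htb
    · rw [min_eq_left htb, indicator_of_mem (show t ∈ Ioc a b from ⟨hta, htb⟩)]
    · rw [min_eq_right htb.le, hGb, indicator_of_notMem fun h => absurd h.2 (not_le.2 htb)]

theorem sq_sum_of_mul_eq_zero {ι : Type*} [Fintype ι] (c e : ι → ℝ)
    (he : ∀ i j, i ≠ j → e i * e j = 0) : (∑ i, c i * e i) ^ 2 = ∑ i, c i ^ 2 * e i ^ 2 := by
  rw [sq, Finset.sum_mul_sum]
  refine Finset.sum_congr rfl fun i _ => ?_
  rw [Finset.sum_eq_single i (fun j _ hj => ?_) (by simp)]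
  · ring
  · linear_combination c i * c j * he i j hj.symm

theorem memLp_indicator_Ioc {a b : ℝ} {f : ℝ → ℝ} (hf : ContinuousOn f (Icc a b)) :
    MemLp ((Ioc a b).indicator f) 2 volume :=
  (memLp_indicator_iff_restrict measurableSet_Ioc).2
    (hf.memLp_restrict_Icc.mono_measure (Measure.restrict_mono_set _ Ioc_subset_Icc_self))

/-- The multiples of a vector by finite combinations of functions on disjoint intervals, extended
by zero. -/
def bumpMap {E : Type*} [NormedAddCommGroup E] [NormedSpace ℝ E] {k : ℕ} (e : Fin k → ℝ → ℝ)
    (w : E) : (Fin k → ℝ) →ₗ[ℝ] (ℝ → E) where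
  toFun c t := (∑ i, c i * e i t) • w
  map_add' c c' := by
    ext t; simp [add_mul, Finset.sum_add_distrib, add_smul]
  map_smul' x c := by
    ext t; simp [mul_assoc, ← Finset.mul_sum, mul_smul]

theorem bumpMap_apply {E : Type*} [NormedAddCommGroup E] [NormedSpace ℝ E] {k : ℕ}
    (e : Fin k → ℝ → ℝ) (w : E) (c : Fin k → ℝ) (t : ℝ) :
    bumpMap e w c t = (∑ i, c i * e i t) • w := rfl

theorem bilin_bumpMap {E : Type*} [NormedAddCommGroup E] [NormedSpace ℝ E] {k : ℕ}
    (B : E →L[ℝ] E →L[ℝ] ℝ) (e : Fin k → ℝ → ℝ) (w : E) (c : Fin k → ℝ) (t : ℝ) :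
    B (bumpMap e w c t) (bumpMap e w c t) = (∑ i, c i * e i t) ^ 2 * B w w := by
  simp only [bumpMap_apply, map_smul, smul_apply, smul_eq_mul]
  ring

theorem memLp_bumpMap {E : Type*} [NormedAddCommGroup E] [NormedSpace ℝ E] {k : ℕ}
    {e : Fin k → ℝ → ℝ} {μ : Measure ℝ} (he : ∀ i, MemLp (e i) 2 μ) (w : E) (c : Fin k → ℝ) :
    MemLp (bumpMap e w c) 2 μ := by
  have h1 : MemLp (fun t => ∑ i, c i * e i t) 2 μ :=
    memLp_finsetSum _ fun i _ => (he i).const_mul (c i)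
  exact (ContinuousLinearMap.toSpanSingleton ℝ w).comp_memLp' h1

theorem integral_bumpMap {E : Type*} [NormedAddCommGroup E] [NormedSpace ℝ E] [CompleteSpace E]
    {k : ℕ} {e e' : Fin k → ℝ → ℝ} {t : ℝ} (he' : ∀ i, IntervalIntegrable (e' i) volume 0 t)
    (h : ∀ i, ∫ τ in 0..t, e' i τ = e i t) (w : E) (c : Fin k → ℝ) :
    bumpMap e w c t = ∫ τ in 0..t, bumpMap e' w c τ := by
  simp only [bumpMap_apply]
  rw [intervalIntegral.integral_smul_const, intervalIntegral.integral_finsetSum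
    fun i _ => (he' i).const_mul (c i)]
  simp only [intervalIntegral.integral_const_mul, h]

theorem secondVariation_zero (m : Fin n → ℝ) (a b : ℝ) (q : ℝ → Config n d) :
    secondVariation m a b q 0 = 0 := by
  have h : (fun ε : ℝ => action m a b (q + ε • (0 : ℝ → Config n d))) =
      fun _ => action m a b q := by
    funext ε; rw [smul_zero, add_zero]
  rw [secondVariation, h, iteratedDeriv_const]
  simp

/-- Disjoint arcs on which the scalar index form in a fixed direction is negative bound the Morse
index from below. -/
theorem IsCollidingHomothetic.le_morseIndex {m : Fin n → ℝ} (hm : ∀ i, 0 < m i)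
    {s : Config n d} {T : ℝ} {r : ℝ → ℝ} {q : ℝ → Config n d}
    (H : IsCollidingHomothetic m s T r q) (hrc : ContinuousOn r (Ico 0 T)) {κ : ℝ}
    {w : Config n d} (hwX : w ∈ configSpace m) (hw0 : w ≠ 0)
    (hw : fderiv ℝ (fderiv ℝ (potential m)) s w w = -κ * inner ℝ (massMap m w) w)
    {B : ℝ} (hB : B ∈ Ioo 0 T) {k : ℕ} {a b : Fin k → ℝ} (ha : ∀ i, 0 ≤ a i)
    (hab : ∀ i, a i < b i) (hbB : ∀ i, b i < B)
    (hdisj : Pairwise (Function.onFun Disjoint fun i => Ioc (a i) (b i))) {G G' : ℝ → ℝ}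
    (hG : ∀ i, ∀ t ∈ Icc (a i) (b i), HasDerivAt G (G' t) t)
    (hG' : ∀ i, ContinuousOn G' (Icc (a i) (b i)))
    (hGa : ∀ i, G (a i) = 0) (hGb : ∀ i, G (b i) = 0)
    (hneg : ∀ i, (∫ t in a i..b i, G' t ^ 2) -
      ∫ t in a i..b i, κ * (r t ^ 3)⁻¹ * G t ^ 2 < 0) :
    (k : ℕ∞) ≤ morseIndex m 0 B q := by
  set e : Fin k → ℝ → ℝ := fun i => (Ioc (a i) (b i)).indicator G with he
  set e' : Fin k → ℝ → ℝ := fun i => (Ioc (a i) (b i)).indicator G' with he'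
  have hGc : ∀ i, ContinuousOn G (Icc (a i) (b i)) := fun i t ht =>
    (hG i t ht).continuousAt.continuousWithinAt
  have horth : ∀ (f : ℝ → ℝ) (t : ℝ) (i j : Fin k), i ≠ j →
      (Ioc (a i) (b i)).indicator f t * (Ioc (a j) (b j)).indicator f t = 0 := by
    intro f t i j hij
    by_cases h : t ∈ Ioc (a i) (b i)
    · rw [indicator_of_notMem (disjoint_left.1 (hdisj hij) h), mul_zero]
    · rw [indicator_of_notMem h, zero_mul]
  have hsq : ∀ (f : ℝ → ℝ) (c : Fin k → ℝ) (t : ℝ),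
      (∑ i, c i * (Ioc (a i) (b i)).indicator f t) ^ 2 =
      ∑ i, c i ^ 2 * (Ioc (a i) (b i)).indicator (fun t => f t ^ 2) t := by
    intro f c t
    rw [sq_sum_of_mul_eq_zero _ _ (horth f t)]
    refine Finset.sum_congr rfl fun i _ => ?_
    by_cases h : t ∈ Ioc (a i) (b i) <;> simp [h]
  have hmem' : ∀ i, MemLp (e' i) 2 (volume.restrict (Icc 0 B)) := fun i =>
    (memLp_indicator_Ioc (hG' i)).restrict _
  have hi' : ∀ i t, 0 ≤ t → t ≤ B → IntervalIntegrable (e' i) volume 0 t := fun i t h0 ht =>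
    (intervalIntegrable_of_memLp hB.1.le (hmem' i)).mono_set (by
      rw [uIcc_of_le h0, uIcc_of_le hB.1.le]; exact Icc_subset_Icc_right ht)
  have hrep : ∀ (c : Fin k → ℝ), ∀ t ∈ Icc 0 B,
      bumpMap e w c t = ∫ τ in 0..t, bumpMap e' w c τ := by
    intro c t ht
    exact integral_bumpMap (fun i => hi' i t ht.1 ht.2) (fun i => integral_indicator_deriv (ha i)
      (hab i).le ht.1 (hG i) (hG' i) (hGa i) (hGb i)) w c
  have hLp : ∀ c, MemLp (bumpMap e' w c) 2 (volume.restrict (Icc 0 B)) :=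
    memLp_bumpMap hmem' w
  have hsob : ∀ c, bumpMap e w c ∈ sobolevZero m 0 B := by
    refine fun c => ⟨fun t => Submodule.smul_mem _ _ hwX, fun t ht => ?_, _, hLp c, hrep c⟩
    have : ∑ i, c i * e i t = 0 := Finset.sum_eq_zero fun i _ => by
      have hnot : t ∉ Ioc (a i) (b i) := fun h =>
        ht ⟨(ha i).trans_lt h.1, h.2.trans_lt (hbB i)⟩
      rw [he]
      simp [hnot]
    rw [bumpMap_apply, this, zero_smul]
  have hwpos := inner_massMap_self_pos hm hw0
  have hrinv : ContinuousOn (fun t => κ * (r t ^ 3)⁻¹) (Icc 0 B) := by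
    have hsub : Icc 0 B ⊆ Ico 0 T := fun t ht => ⟨ht.1, ht.2.trans_lt hB.2⟩
    exact (((hrc.mono hsub).pow 3).inv₀
      fun t ht => pow_ne_zero 3 (H.r_pos t (hsub ht)).ne').const_mul _
  have hint : ∀ i {f : ℝ → ℝ}, ContinuousOn f (Icc (a i) (b i)) →
      IntervalIntegrable ((Ioc (a i) (b i)).indicator f) volume 0 B := fun i f hf =>
    intervalIntegrable_of_memLp hB.1.le ((memLp_indicator_Ioc hf).restrict _)
  have hsum : ∀ (c : Fin k → ℝ) (f : ℝ → ℝ), (∀ i, ContinuousOn f (Icc (a i) (b i))) →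
      ∫ t in 0..B, ∑ i, c i ^ 2 * (Ioc (a i) (b i)).indicator f t =
      ∑ i, c i ^ 2 * ∫ t in a i..b i, f t := by
    intro c f hf
    rw [intervalIntegral.integral_finsetSum fun i _ => (hint i (hf i)).const_mul _]
    refine Finset.sum_congr rfl fun i _ => ?_
    rw [intervalIntegral.integral_const_mul,
      integral_indicator_Ioc (ha i) (hab i).le (hbB i).le]
  -- Disjoint supports remove the cross terms: the form is diagonal in the coefficients c.
  have hval : ∀ c, secondVariation m 0 B q (bumpMap e w c) = inner ℝ (massMap m w) w *
      ∑ i, c i ^ 2 * ((∫ t in a i..b i, G' t ^ 2) -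
        ∫ t in a i..b i, κ * (r t ^ 3)⁻¹ * G t ^ 2) := by
    intro c
    rw [H.secondVariation_eq hB (hLp c) (hrep c)]
    have h1 : ∫ t in 0..B, massForm m (bumpMap e' w c t) (bumpMap e' w c t) =
        inner ℝ (massMap m w) w * ∑ i, c i ^ 2 * ∫ t in a i..b i, G' t ^ 2 := by
      rw [← hsum c (fun t => G' t ^ 2) fun i => (hG' i).pow 2,
        ← intervalIntegral.integral_const_mul]
      refine intervalIntegral.integral_congr fun t _ => ?_
      simp only [bilin_bumpMap, massForm_apply]
      rw [← hsq G' c t]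
      ring
    have h2 : ∫ t in 0..B, (r t ^ 3)⁻¹ * fderiv ℝ (fderiv ℝ (potential m)) s
          (bumpMap e w c t) (bumpMap e w c t) =
        -(inner ℝ (massMap m w) w *
          ∑ i, c i ^ 2 * ∫ t in a i..b i, κ * (r t ^ 3)⁻¹ * G t ^ 2) := by
      rw [← hsum c (fun t => κ * (r t ^ 3)⁻¹ * G t ^ 2) fun i =>
        (hrinv.mono (Icc_subset_Icc (ha i) (hbB i).le)).mul
        ((hGc i).pow 2), ← intervalIntegral.integral_const_mul, ← intervalIntegral.integral_neg]
      refine intervalIntegral.integral_congr fun t _ => ?_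
      simp only [bilin_bumpMap, hw]
      have h3 : ∑ i, c i ^ 2 * (Ioc (a i) (b i)).indicator
          (fun t => κ * (r t ^ 3)⁻¹ * G t ^ 2) t = κ * (r t ^ 3)⁻¹ * (∑ i, c i * e i t) ^ 2 := by
        rw [hsq G c t, Finset.mul_sum]
        refine Finset.sum_congr rfl fun i _ => ?_
        by_cases h : t ∈ Ioc (a i) (b i)
        · simp only [indicator_of_mem h]; ring
        · simp only [indicator_of_notMem h]; ring
      rw [h3]
      ring
    rw [h1, h2, ← sub_eq_add_neg, ← mul_sub, ← Finset.sum_sub_distrib]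
    simp only [mul_sub]
  have hvneg : ∀ c, c ≠ 0 → secondVariation m 0 B q (bumpMap e w c) < 0 := by
    intro c hc
    rw [hval c]
    refine mul_neg_of_pos_of_neg hwpos ?_
    obtain ⟨i, hi⟩ := Function.ne_iff.1 hc
    exact Finset.sum_neg' (fun j _ => mul_nonpos_of_nonneg_of_nonpos (sq_nonneg _) (hneg j).le)
      ⟨i, Finset.mem_univ i, mul_neg_of_pos_of_neg (sq_pos_of_ne_zero hi) (hneg i)⟩
  -- Negativity itself gives independence: a nonzero c in the kernel would make the form negative at
  -- the zero path.
  have hinj : Function.Injective (bumpMap e w) := by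
    refine (injective_iff_map_eq_zero _).2 fun c hc => ?_
    by_contra h0
    have := hvneg c h0
    rw [hc, secondVariation_zero] at this
    exact lt_irrefl _ this
  have hrank : Cardinal.toENat (Module.rank ℝ (LinearMap.range (bumpMap e w))) = k := by
    rw [← (LinearEquiv.ofInjective _ hinj).rank_eq, rank_fin_fun]
    simp
  rw [← hrank, morseIndex]
  refine le_iSup₂_of_le (LinearMap.range (bumpMap e w)) ⟨?_, ?_⟩ le_rfl
  · rintro _ ⟨c, rfl⟩
    exact hsob c
  · rintro _ ⟨c, rfl⟩ h0
    exact hvneg c fun hc => h0 (by rw [hc, map_zero])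

theorem hasMorseIndex_top {m : Fin n → ℝ} (hm : ∀ i, 0 < m i)
    {s : Config n d} (hs : IsCentralConfig m s) (hsp : IsSpiral m s) {T : ℝ} {r : ℝ → ℝ}
    {q : ℝ → Config n d} (H : IsCollidingHomothetic m s T r q) : HasMorseIndex m T q ⊤ := by
  obtain ⟨κ, hκ, w, hwX, hw0, hw⟩ := hsp.exists_direction
  have hK := H.isKeplerCollapse hm hs
  have hu := hs.potential_pos hm
  set u := potential m s
  obtain ⟨ε, hε, hκε⟩ : ∃ ε > 0, κ = 9 / 8 * u + 2 * ε :=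
    ⟨(κ - 9 / 8 * u) / 2, by linarith, by ring⟩
  -- With these choices A/4 = 9u/8 + ε and β²A = ε/2, so (1/4 + β²)A stays ε/2 below κ = 9u/8 + 2ε.
  set A := 9 / 2 * u + 4 * ε with hA
  have hA0 : 0 < A := by positivity
  set β := √(ε / (2 * A)) with hβ
  have hβ0 : 0 < β := Real.sqrt_pos.2 (by positivity)
  have hβ2 : (1 / 4 + β ^ 2) * A < κ := by
    rw [hβ, Real.sq_sqrt (by positivity), add_mul]
    have : ε / (2 * A) * A = ε / 2 := by field_simp
    rw [this, hκε, hA]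
    linarith
  obtain ⟨t₀, ht₀, hcube⟩ := hK.cube_le (δ := 4 * ε) (by positivity)
  -- the zeros of the comparison solution
  set τ : ℕ → ℝ := fun j => T - Real.exp (-(j * Real.pi / β)) with hτ
  have hτT : ∀ j, τ j < T := fun j => by
    simp only [hτ]; linarith [Real.exp_pos (-(j * Real.pi / β))]
  have hτmono : StrictMono τ := strictMono_nat_of_lt_succ fun j => by
    have : Real.exp (-(((j + 1 : ℕ) : ℝ) * Real.pi / β)) < Real.exp (-(j * Real.pi / β)) := by
      refine Real.exp_lt_exp.2 (neg_lt_neg ?_)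
      push_cast
      gcongr
      linarith
    simp only [hτ]
    linarith
  have hτlim : Tendsto τ atTop (𝓝 T) := by
    have h1 : Tendsto (fun j : ℕ => (j : ℝ) * Real.pi / β) atTop atTop :=
      (tendsto_natCast_atTop_atTop.atTop_mul_const Real.pi_pos).atTop_div_const hβ0
    simpa using (Real.tendsto_exp_neg_atTop_nhds_zero.comp h1).const_sub T
  have hlog : ∀ j, β * Real.log (T - τ j) = -(j * Real.pi) := fun j => by
    simp only [hτ, sub_sub_cancel, Real.log_exp]
    field_simp
  set G : ℝ → ℝ := fun t => √(T - t) * Real.sin (β * Real.log (T - t)) with hGdef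
  have hGτ : ∀ j, G (τ j) = 0 := fun j => by
    simp only [hGdef, hlog, Real.sin_neg, Real.sin_nat_mul_pi, neg_zero, mul_zero]
  have hGne : ∀ j, ∀ t ∈ Ioo (τ j) (τ (j + 1)), G t ≠ 0 := by
    intro j t ht
    have htT : t < T := ht.2.trans (hτT _)
    refine mul_ne_zero (Real.sqrt_pos.2 (sub_pos.2 htT)).ne' fun h0 => ?_
    -- Between consecutive τ's the phase lies strictly between −(j+1)π and −jπ, leaving no integer
    -- multiple of π.
    obtain ⟨z, hz⟩ := Real.sin_eq_zero_iff.1 h0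
    have h1 := mul_lt_mul_of_pos_left (Real.log_lt_log (sub_pos.2 htT)
      (sub_lt_sub_left ht.1 T)) hβ0
    have h2 := mul_lt_mul_of_pos_left (Real.log_lt_log (sub_pos.2 (hτT (j + 1)))
      (sub_lt_sub_left ht.2 T)) hβ0
    rw [hlog, ← hz, ← neg_mul] at h1 h2
    have h3 := lt_of_mul_lt_mul_right h1 Real.pi_pos.le
    have h4 := lt_of_mul_lt_mul_right h2 Real.pi_pos.le
    have h5 : z < -(j : ℤ) := by exact_mod_cast h3
    have h6 : -((j : ℤ) + 1) < z := by exact_mod_cast h4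
    omega
  -- Zeros up to t₀ are discarded, so that the cubic bound on r holds on every arc used.
  obtain ⟨N, hN⟩ := (hτlim.eventually (lt_mem_nhds ht₀.2)).exists
  have hpos : ∀ i, 0 ≤ τ (N + i) := fun i =>
    ht₀.1.trans (hN.le.trans (hτmono.monotone (Nat.le_add_right N i)))
  intro t ht htlim
  rw [ENat.tendsto_nhds_top_iff_natCast_lt]
  intro k
  -- The strict inequality k < index requires k + 1 arcs, the last ending at τ (N + (k + 1)).
  filter_upwards [htlim.eventually (lt_mem_nhds (hτT (N + (k + 1))))] with j hj
  refine lt_of_lt_of_le (b := ((k + 1 : ℕ) : ℕ∞)) (by exact_mod_cast Nat.lt_succ_self k) ?_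
  have hIcc : ∀ i, ∀ x ∈ Icc (τ (N + i)) (τ (N + i + 1)), t₀ < x ∧ x < T := fun i x hx =>
    ⟨(hN.trans_le (hτmono.monotone (Nat.le_add_right N i))).trans_le hx.1,
      hx.2.trans_lt (hτT _)⟩
  refine H.le_morseIndex hm hK.continuousOn hwX hw0 hw (ht j)
    (a := fun i : Fin (k + 1) => τ (N + i)) (b := fun i : Fin (k + 1) => τ (N + i + 1))
    (fun i => hpos i) (fun i => hτmono (Nat.lt_succ_self _))
    (fun i => (hτmono.monotone (by omega)).trans_lt hj) ?_ (G := G)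
    (fun i x hx => hasDerivAt_oscillating T β (hIcc i x hx).2)
    (fun i x hx => (hasDerivAt_oscillating_deriv T β
      (hIcc i x hx).2).continuousAt.continuousWithinAt)
    (fun i => hGτ _) (fun i => hGτ _) fun i => ?_
  · have key : ∀ i i' : Fin (k + 1), i < i' →
        Disjoint (Ioc (τ (N + i)) (τ (N + i + 1))) (Ioc (τ (N + i')) (τ (N + i' + 1))) := by
      intro i i' hii
      refine Ioc_disjoint_Ioc_of_le (hτmono.monotone ?_)
      have : (i : ℕ) < i' := hii
      omega
    intro i i' hii
    rcases lt_or_gt_of_ne hii with h | h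
    · exact key i i' h
    · exact (key i' i h).symm
  · have hsub : Icc (τ (N + i)) (τ (N + i + 1)) ⊆ Ico 0 T := fun x hx =>
      ⟨(hpos i).trans hx.1, (hIcc i x hx).2⟩
    refine integral_neg_of_comparison (W := fun t => (1 / 4 + β ^ 2) / (T - t) ^ 2)
      (hτmono (Nat.lt_succ_self _))
      (fun x hx => hasDerivAt_oscillating T β (hIcc i x hx).2)
      (fun x hx => hasDerivAt_oscillating_deriv T β (hIcc i x hx).2) ?_ ?_ (fun x hx => ?_)
      (hGτ _) (hGτ _) (hGne _)
    · exact (((hK.continuousOn.mono hsub).pow 3).inv₀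
        fun x hx => pow_ne_zero 3 (hK.pos x (hsub hx)).ne').const_mul _
    · exact continuousOn_const.div (by fun_prop)
        fun x hx => pow_ne_zero 2 (sub_pos.2 (hIcc i x hx).2).ne'
    · have hr := hK.pos x (hsub hx)
      have hx0 : 0 < T - x := sub_pos.2 (hIcc i x hx).2
      have h1 := hcube x (hIcc i x hx)
      rw [← div_eq_mul_inv, div_lt_div_iff₀ (by positivity) (by positivity)]
      calc (1 / 4 + β ^ 2) * r x ^ 3 ≤ (1 / 4 + β ^ 2) * (A * (T - x) ^ 2) := by gcongr
        _ = (1 / 4 + β ^ 2) * A * (T - x) ^ 2 := by ring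
        _ < κ * (T - x) ^ 2 := by gcongr

end NBody

theorem mainTheorem1 {n d : ℕ} (m : Fin n → ℝ) (hm : ∀ i, 0 < m i)
    (s₀ : NBody.Config n d) (hs₀ : NBody.IsCentralConfig m s₀)
    (T : ℝ) (r : ℝ → ℝ) (q : ℝ → NBody.Config n d)
    (hq : NBody.IsCollidingHomothetic m s₀ T r q) :
    (NBody.IsSpiral m s₀ → NBody.HasMorseIndex m T q ⊤) ∧
    (NBody.IsNonSpiral m s₀ → derivWithin r (Set.Ico 0 T) 0 ≤ 0 →
      NBody.HasMorseIndex m T q 0) :=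
  ⟨fun h => NBody.hasMorseIndex_top hm hs₀ h hq,
    fun h h0 => NBody.hasMorseIndex_zero hm hs₀ h hq h0⟩
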